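/- Let $Z(t)=e^{i\vartheta(t)}\zeta(\tfrac12+it)$ with $\vartheta(t)=-\tfrac t2\ln\pi+\operatorname{Im}\ln\Gamma(\tfrac14+\tfrac{it}2)$, so that $Z^2(t)=|\zeta(\tfrac12+it)|^2$. Let $y_0>0$ and let $\mu\in C^\infty([y_0,\infty))$ be real-valued, increasing and unbounded from above, with $\mu(y)\ge 7y\ln y$ for $y\ge y_0$. For all sufficiently large $T$ let $x=\varphi(T)\ge y_0$ be the solution of $$\int_0^{\mu(x)}Z^2(t)e^{-\frac2x t}\,dt=\int_0^TZ^2(t)\,dt ,$$ and put $\varphi_1(T)=\tfrac12\varphi(T)$ (Jacob's ladder) and $\tilde Z^2(t)=\varphi_1'(t)$. Write $\varphi_1^0(t)=t$, $\varphi_1^{r}(t)=\varphi_1(\varphi_1^{r-1}(t))$ for the iterations of $\varphi_1$ and $\varphi_1^{-p}$ for the $p$-th iterate of the inverse function $\varphi_1^{-1}$. For $a\in\mathbb R$, $l>0$, $p\ge1$ and $t\in[a,a+2l]$ put $$u_{p,T}(t)=\frac{\varphi_1^{-p}(T+2l)-\varphi_1^{-p}(T)}{2l}(t-a)+\varphi_1^{-p}(T),\qquad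 w_{p,T}(t)=\prod_{r=0}^{p-1}\tilde Z^2\big(\varphi_1^r(u_{p,T}(t))\big).$$ Let $\{f_n\}_{n=0}^\infty$ be an orthogonal system of real functions in $L^2([a,a+2l])$ and let $k\in\mathbb N$. (i) For all sufficiently large $T>0$ and each $p=1,\dots,k$, the function $w_{p,T}$ is a weight on $[a,a+2l]$ (defined everywhere, non-negative, positive almost everywhere, integrable), and the functions $$g_n(t)=f_n\big(\varphi_1^p(u_{p,T}(t))-T+a\big),\qquad n=0,1,2,\dots,$$ form an orthogonal system in $L^2([a,a+2l],w_{p,T}(t)\,dt)$: $\int_a^{a+2l}g_m(t)g_n(t)w_{p,T}(t)\,dt=0$ for $m\ne n$. Moreover $\int_a^{a+2l}g_n^2(t)w_{p,T}(t)\,dt\neq0$ whenever $\int_a^{a+2l}f_n^2(t)\,dt\ne0$. (ii) If $\mu(y)=\alpha y\ln y$ for $y\ge y_0$, with some $\alpha\in[7,8]$, then for each $p=1,\dots,k$ $$w_{p,T}(t)\sim\frac1{\ln^pT}\prod_{r=0}^{p-1}\Big|\zeta\big(\tfrac12+i\varphi_1^r(u_{p,T}(t))\big)\Big|^2,\qquad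 T\to\infty,$$ uniformly in $t\in[a,a+2l]$; that is, the difference of the two sides is $o(1)$ times the right-hand side, uniformly in $t$. -/

import Mathlib

open MeasureTheory Filter Asymptotics Set

namespace JacobLadder

noncomputable section

/-- The Riemann-Siegel theta function
`θ(t) = -(t/2) ln π + Im ln Γ(1/4 + i t/2)`, with the principal logarithm.  Another branch of
`ln Γ` changes `θ(t)` by a multiple of `2π`; only `exp (i θ(t))` is used below. -/
def theta (t : ℝ) : ℝ :=
  -(t / 2) * Real.log Real.pi + (Complex.log (Complex.Gamma (1 / 4 + Complex.I * (t / 2)))).im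

/-- Hardy's function `Z(t) = exp (i θ(t)) ζ(1/2 + i t)`; this number is real, see
`hardyZ_eq`, and is stored as a real number. -/
def hardyZ (t : ℝ) : ℝ :=
  (Complex.exp (Complex.I * theta t) * riemannZeta (1 / 2 + Complex.I * t)).re

theorem hardyZ_eq (t : ℝ) :
    (hardyZ t : ℂ) = Complex.exp (Complex.I * theta t) * riemannZeta (1 / 2 + Complex.I * t) := by
  have hpi : (0 : ℝ) < Real.pi := Real.pi_pos
  set s : ℂ := 1 / 2 + Complex.I * t with hs
  have hsre : s.re = 1 / 2 := by simp [hs]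
  have hs0 : s ≠ 0 := by intro h; rw [h] at hsre; norm_num at hsre
  have hs1 : 1 - s ≠ 0 := by
    intro h
    have h2 := congrArg Complex.re h
    rw [Complex.sub_re, hsre] at h2; norm_num at h2
  have hconj : (starRingEnd ℂ) s = 1 - s := by
    apply Complex.ext
    · simp [hs]; norm_num
    · simp [hs]
  have hs2 : s / 2 = 1 / 4 + Complex.I * (t / 2) := by rw [hs]; ring
  set g : ℂ := Complex.Gamma (1 / 4 + Complex.I * (t / 2)) with hg
  have hg0 : g ≠ 0 := by
    apply Complex.Gamma_ne_zero_of_re_pos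
    simp
  have hG : Complex.Gammaℝ s
      = ((Real.exp (-(1 / 4) * Real.log Real.pi) * ‖g‖ : ℝ) : ℂ)
        * Complex.exp (Complex.I * theta t) := by
    have h1 : g = (‖g‖ : ℂ) * Complex.exp (Complex.I * ((Complex.log g).im : ℂ)) := by
      rw [Complex.log_im, mul_comm Complex.I]
      exact (Complex.norm_mul_exp_arg_mul_I g).symm
    rw [Complex.Gammaℝ_def, hs2, ← hg, neg_div, hs2,
      Complex.cpow_def_of_ne_zero (by exact_mod_cast hpi.ne'), ← Complex.ofReal_log hpi.le]
    conv_lhs => rw [h1]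
    simp only [theta, ← hg]
    push_cast
    rw [mul_left_comm, mul_comm (Complex.exp (-(1 / 4) * _)), mul_assoc, ← Complex.exp_add,
      ← Complex.exp_add]
    congr 2
    ring
  have hL : ((starRingEnd ℂ) (Complex.Gammaℝ s * riemannZeta s))
      = Complex.Gammaℝ s * riemannZeta s := by
    have hzr : ∀ z : ℂ, z ≠ 0 → 0 < z.re →
        Complex.Gammaℝ z * riemannZeta z = completedRiemannZeta z := by
      intro z hz hzre
      rw [riemannZeta_def_of_ne_zero hz, mul_div_cancel₀ _ (Complex.Gammaℝ_ne_zero_of_re_pos hzre)]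
    have hGc : (starRingEnd ℂ) (Complex.Gammaℝ s) = Complex.Gammaℝ (1 - s) := by
      rw [← hconj, Complex.Gammaℝ_def, Complex.Gammaℝ_def, map_mul, ← Complex.Gamma_conj,
        map_div₀]
      congr 1
      · rw [Complex.cpow_def_of_ne_zero (by exact_mod_cast hpi.ne'),
          Complex.cpow_def_of_ne_zero (by exact_mod_cast hpi.ne'), ← Complex.exp_conj, map_mul,
          ← Complex.ofReal_log hpi.le, Complex.conj_ofReal, map_div₀, map_neg, map_ofNat]
      · rw [map_ofNat]
    rw [map_mul, hGc, ← riemannZeta_conj, hconj, hzr _ hs1 (by rw [Complex.sub_re, hsre]; norm_num),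
      hzr _ hs0 (by rw [hsre]; norm_num), completedRiemannZeta_one_sub]
  have hc : Real.exp (-(1 / 4) * Real.log Real.pi) * ‖g‖ ≠ 0 :=
    mul_ne_zero (Real.exp_pos _).ne' (norm_ne_zero_iff.mpr hg0)
  rw [hG, mul_assoc, map_mul, Complex.conj_ofReal] at hL
  have h3 := mul_left_cancel₀ (by exact_mod_cast hc) hL
  exact Complex.conj_eq_iff_re.mp h3

/-- `Z(t)² = |ζ(1/2 + i t)|²`. -/
theorem hardyZ_sq (t : ℝ) : hardyZ t ^ 2 = ‖riemannZeta (1 / 2 + Complex.I * t)‖ ^ 2 := by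
  have h := congrArg norm (hardyZ_eq t)
  rw [norm_mul, mul_comm Complex.I, Complex.norm_exp_ofReal_mul_I, one_mul, Complex.norm_real,
    Real.norm_eq_abs] at h
  rw [← sq_abs, h, mul_comm]

/-- The class of functions `μ` that generate Jacob's ladders: smooth on `[y₀, ∞)`, increasing,
unbounded from above, and with `μ(y) ≥ 7 y ln y`. -/
structure IsGenerator (μ : ℝ → ℝ) (y₀ : ℝ) : Prop where
  pos : 0 < y₀
  smooth : ContDiffOn ℝ (⊤ : ℕ∞) μ (Ici y₀)
  mono : MonotoneOn μ (Ici y₀)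
  unbounded : ∀ M : ℝ, ∃ y ∈ Ici y₀, M < μ y
  growth : ∀ y ∈ Ici y₀, 7 * y * Real.log y ≤ μ y

/-- `x ↦ ∫_0^{μ(x)} Z²(t) exp (-(2/x) t) dt`. -/
def smoothed (μ : ℝ → ℝ) (x : ℝ) : ℝ :=
  ∫ t in (0 : ℝ)..μ x, hardyZ t ^ 2 * Real.exp (-(2 / x) * t)

/-- The Hardy-Littlewood integral `∫_0^T Z²(t) dt`. -/
def hardyLittlewood (T : ℝ) : ℝ := ∫ t in (0 : ℝ)..T, hardyZ t ^ 2

/-- The set of all `T > 0` for which the integral equation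
`∫_0^{μ(x)} Z²(t) exp (-(2/x) t) dt = ∫_0^T Z²(t) dt` has a solution `x ≥ y₀`. -/
def domain (μ : ℝ → ℝ) (y₀ : ℝ) : Set ℝ :=
  {T | 0 < T ∧ ∃ x ∈ Ici y₀, smoothed μ x = hardyLittlewood T}

/-- `φ(T)`: the solution `x ≥ y₀` of
`∫_0^{μ(x)} Z²(t) exp (-(2/x) t) dt = ∫_0^T Z²(t) dt` (junk outside `domain μ y₀`). -/
def phi (μ : ℝ → ℝ) (y₀ : ℝ) (T : ℝ) : ℝ :=
  Function.invFunOn (smoothed μ) (Ici y₀) (hardyLittlewood T)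

/-- Jacob's ladder `φ₁ = φ / 2`. -/
def phi₁ (μ : ℝ → ℝ) (y₀ : ℝ) (T : ℝ) : ℝ := phi μ y₀ T / 2

/-- `Z̃²(t) = dφ₁(t)/dt`. -/
def ZtildeSq (μ : ℝ → ℝ) (y₀ : ℝ) (t : ℝ) : ℝ := deriv (phi₁ μ y₀) t

/-- The inverse function `φ₁⁻¹` of the ladder `φ₁` on its domain. -/
def phi₁Inv (μ : ℝ → ℝ) (y₀ : ℝ) (T : ℝ) : ℝ :=
  Function.invFunOn (phi₁ μ y₀) (domain μ y₀) T

/-- The `p`-th reverse iteration `φ₁^{-p}(T)` of the point `T`. -/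
def reverseIter (μ : ℝ → ℝ) (y₀ : ℝ) (p : ℕ) (T : ℝ) : ℝ := (phi₁Inv μ y₀)^[p] T

/-- The affine map of `[a, a + 2l]` onto `[φ₁^{-p}(T), φ₁^{-p}(T + 2l)]`. -/
def affine (μ : ℝ → ℝ) (y₀ a l : ℝ) (p : ℕ) (T t : ℝ) : ℝ :=
  (reverseIter μ y₀ p (T + 2 * l) - reverseIter μ y₀ p T) / (2 * l) * (t - a)
    + reverseIter μ y₀ p T

/-- The `p`-th iterated system `f_n(φ₁^p(u(t)) - T + a)`, where `u` is the affine map above. -/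
def iterated (μ : ℝ → ℝ) (y₀ a l : ℝ) (f : ℕ → ℝ → ℝ) (p : ℕ) (T : ℝ) (n : ℕ) (t : ℝ) : ℝ :=
  f n ((phi₁ μ y₀)^[p] (affine μ y₀ a l p T t) - T + a)

/-- The `p`-th weight `∏_{r=0}^{p-1} Z̃²(φ₁^r(u(t)))`. -/
def weight (μ : ℝ → ℝ) (y₀ a l : ℝ) (p : ℕ) (T t : ℝ) : ℝ :=
  ∏ r ∈ Finset.range p, ZtildeSq μ y₀ ((phi₁ μ y₀)^[r] (affine μ y₀ a l p T t))

/-- `(1 / ln^p T) ∏_{r=0}^{p-1} |ζ(1/2 + i φ₁^r(u(t)))|²`. -/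
def zetaWeight (μ : ℝ → ℝ) (y₀ a l : ℝ) (p : ℕ) (T t : ℝ) : ℝ :=
  1 / Real.log T ^ p * ∏ r ∈ Finset.range p,
    ‖riemannZeta (1 / 2 + Complex.I * ((phi₁ μ y₀)^[r] (affine μ y₀ a l p T t) : ℝ))‖ ^ 2

/-- `w` is a weight function on `[a, b]`: non-negative, almost everywhere positive, integrable. -/
structure IsWeight (w : ℝ → ℝ) (a b : ℝ) : Prop where
  nonneg : ∀ t ∈ Icc a b, 0 ≤ w t
  pos : ∀ᵐ t ∂(volume.restrict (Icc a b)), 0 < w t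
  integrable : IntegrableOn w (Icc a b)

/-- `(f_n)` is an orthogonal system in the weighted space `L²([a, b], w(t) dt)`. -/
structure IsOrthogonalSystem (w : ℝ → ℝ) (a b : ℝ) (f : ℕ → ℝ → ℝ) : Prop where
  memLp : ∀ n, MemLp (f n) 2
    ((volume.restrict (Icc a b)).withDensity fun t => ENNReal.ofReal (w t))
  orthogonal : ∀ m n, m ≠ n → ∫ t in a..b, f m t * f n t * w t = 0

end

end JacobLadder

/-! Part (i) is a change of variables. The ladder φ₁ is half the composition of the inverse of S =
`smoothed μ` with `hardyLittlewood`, so for large arguments it is strictly increasing and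
differentiable, and by the chain rule the derivative of φ₁^p is the product of Z̃² along the orbit.
Hence v(t) = φ₁^p(u(t)) − T + a maps [a, a+2l] bijectively onto itself with v' = κw, where κ > 0 is
the slope of the affine map u, and ∫ F(v) w dt = κ⁻¹ ∫ F dt for every F. Orthogonality, membership
in L² and non-vanishing of norms all pass from f_n to g_n. The weight vanishes only where the orbit
meets a zero of ζ, which happens for countably many t.

The analysis rests on M(x) = ∫_0^∞ t Z² e^(−2t/x) dt ~ (x²/4) ln x (`tendsto_moment`). Here ζ is
replaced by its partial sum of length ⌈x⌉. The diagonal gives a harmonic sum; the factor t squares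
the denominators of the off-diagonal terms, which therefore contribute only O(x²). The remainder,
controlled by Euler–Maclaurin and Plancherel, also has moment O(x²). One consequence is that ∫ Z²
diverges, so that φ₁ and its inverse are defined on half-lines and tend to infinity.

For (ii), implicit differentiation gives φ₁' = Z²/(2S'(φ)), and S'(x) is (2/x²)M(x) up to a boundary
term and a tail, both negligible for μ(y) = αy ln y with α ≥ 7. So S'(x) ~ (ln x)/2 and φ₁'(t) =
Z²(t)(1 + o(1))/ln φ(t). Crude bounds give ln φ₁(t) ~ ln t, so every logarithm along the orbit may
be replaced by ln T; this is uniform because the r-th point of the orbit lies between φ₁^{-(p-r)}(T)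
and φ₁^{-(p-r)}(T+2l). -/

namespace JacobLadder

/-! ### Plancherel's identity on L¹ ∩ L² -/

section Plancherel

open FourierTransform SchwartzMap

/-- **Plancherel's identity** for the Fourier integral of a function in `L¹ ∩ L²`. -/
theorem eLpNorm_fourier_eq {h : ℝ → ℂ} (h1 : Integrable h) (h2 : MemLp h 2) :
    eLpNorm (𝓕 h) 2 volume = eLpNorm h 2 volume := by
  set g : Lp (α := ℝ) ℂ 2 volume := h2.toLp h with hg
  have hcont : Continuous (𝓕 h) :=
    VectorFourier.fourierIntegral_continuous Real.continuous_fourierChar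
      (by exact continuous_inner) h1
  -- The L² transform and the Fourier integral are compared as distributions: for a test function,
  -- the first passes to it by duality and the second by Fubini.
  have key : ((𝓕 g : Lp (α := ℝ) ℂ 2 volume) : ℝ → ℂ) =ᵐ[volume] 𝓕 h := by
    apply ae_eq_of_integral_contDiff_smul_eq
    · exact (Lp.memLp (𝓕 g : Lp (α := ℝ) ℂ 2 volume)).locallyIntegrable (by norm_num)
    · exact hcont.locallyIntegrable
    intro φ hφ hφc
    have hc : HasCompactSupport (fun x => (φ x : ℂ)) := hφc.comp_left Complex.ofReal_zero
    have hs : ContDiff ℝ ((⊤ : ℕ∞) : WithTop ℕ∞) (fun x => (φ x : ℂ)) :=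
      Complex.ofRealCLM.contDiff.comp hφ
    set Φ : 𝓢(ℝ, ℂ) := hc.toSchwartzMap hs with hΦ
    have e1 := congrArg (fun D => D Φ) (Lp.fourier_toTemperedDistribution_eq g)
    simp only [TemperedDistribution.fourier_apply, Lp.toTemperedDistribution_apply] at e1
    have e2 : ∫ x, Φ x • (𝓕 g : Lp (α := ℝ) ℂ 2 volume) x = ∫ x, φ x • (𝓕 g : Lp (α := ℝ) ℂ 2 volume) x := by
      congr 1
    have e3 : ∫ x, (𝓕 Φ) x • g x = ∫ x, (𝓕 (Φ : ℝ → ℂ)) x • h x := by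
      apply integral_congr_ae
      filter_upwards [h2.coeFn_toLp] with x hx
      rw [hg, hx, SchwartzMap.fourier_coe]
    have e4 : ∫ x, (𝓕 (Φ : ℝ → ℂ)) x • h x = ∫ x, Φ x • (𝓕 h) x := by
      simpa using! VectorFourier.integral_fourierIntegral_smul_eq_flip (L := innerₗ ℝ)
        Real.continuous_fourierChar continuous_inner Φ.integrable h1
    rw [← e2, ← e1, e3, e4]
    rfl
  have hn := Lp.norm_fourier_eq g
  rw [Lp.norm_def, Lp.norm_def, ENNReal.toReal_eq_toReal_iff' (Lp.eLpNorm_ne_top _)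
    (Lp.eLpNorm_ne_top _), eLpNorm_congr_ae key, eLpNorm_congr_ae h2.coeFn_toLp] at hn
  exact hn

theorem lintegral_enorm_sq_fourier_eq {h : ℝ → ℂ} (h1 : Integrable h) (h2 : MemLp h 2) :
    ∫⁻ x, ‖𝓕 h x‖ₑ ^ 2 = ∫⁻ x, ‖h x‖ₑ ^ 2 := by
  have := eLpNorm_fourier_eq h1 h2
  rw [eLpNorm_eq_lintegral_rpow_enorm_toReal (by norm_num) (by norm_num),
    eLpNorm_eq_lintegral_rpow_enorm_toReal (by norm_num) (by norm_num)] at this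
  simpa using ENNReal.rpow_left_injective (x := 1 / (2 : ENNReal).toReal) (by norm_num) this

theorem integrable_norm_sq_fourier {h : ℝ → ℂ} (h1 : Integrable h) (h2 : MemLp h 2) :
    Integrable fun x => ‖𝓕 h x‖ ^ 2 := by
  have hcont : Continuous (𝓕 h) :=
    VectorFourier.fourierIntegral_continuous Real.continuous_fourierChar
      (by exact continuous_inner) h1
  have : MemLp (𝓕 h) 2 := ⟨hcont.aestronglyMeasurable, by rw [eLpNorm_fourier_eq h1 h2]; exact h2.2⟩
  exact (memLp_two_iff_integrable_sq_norm hcont.aestronglyMeasurable).mp this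

theorem integral_norm_sq_fourier_eq {h : ℝ → ℂ} (h1 : Integrable h) (h2 : MemLp h 2) :
    ∫ x, ‖𝓕 h x‖ ^ 2 = ∫ x, ‖h x‖ ^ 2 := by
  have e : ∀ z : ℂ, ENNReal.ofReal (‖z‖ ^ 2) = ‖z‖ₑ ^ 2 := fun z => by
    rw [ENNReal.ofReal_pow (norm_nonneg _), ofReal_norm]
  rw [integral_eq_lintegral_of_nonneg_ae (.of_forall fun _ => by positivity)
      (integrable_norm_sq_fourier h1 h2).1,
    integral_eq_lintegral_of_nonneg_ae (.of_forall fun _ => by positivity)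
      ((memLp_two_iff_integrable_sq_norm h2.1).mp h2).1]
  simp_rw [e]
  rw [lintegral_enorm_sq_fourier_eq h1 h2]

end Plancherel

end JacobLadder

/-! ### Euler–Maclaurin for ζ and the mean square of its tail integral -/

namespace JacobLadder

/-- The fractional part, cut off below `N`. -/
noncomputable def fracTail (N : ℕ) : ℝ → ℂ :=
  (Ioi (N : ℝ)).indicator fun u => ((Int.fract u : ℝ) : ℂ)

theorem measurable_fracTail (N : ℕ) : Measurable (fracTail N) :=
  (Complex.measurable_ofReal.comp measurable_fract).indicator measurableSet_Ioi

theorem norm_fracTail_le_one (N : ℕ) (u : ℝ) : ‖fracTail N u‖ ≤ 1 := by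
  unfold fracTail
  by_cases h : u ∈ Ioi (N : ℝ)
  · rw [indicator_of_mem h, Complex.norm_real, Real.norm_of_nonneg (Int.fract_nonneg u)]
    exact (Int.fract_lt_one u).le
  · simp [indicator_of_notMem h]

theorem fracTail_of_le {N : ℕ} {u : ℝ} (h : u ≤ N) : fracTail N u = 0 :=
  indicator_of_notMem (by simpa using h) _

theorem locallyIntegrable_fracTail (N : ℕ) : LocallyIntegrable (fracTail N) :=
  (locallyIntegrable_const (1 : ℝ)).mono (measurable_fracTail N).aestronglyMeasurable
    (.of_forall fun u => by simpa using norm_fracTail_le_one N u)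

theorem fracTail_isBigO_atTop (N : ℕ) : fracTail N =O[atTop] fun u : ℝ => u ^ (-(0 : ℝ)) := by
  refine IsBigO.of_bound 1 (.of_forall fun u => ?_)
  simpa using norm_fracTail_le_one N u

/-- The cut-off removes a neighbourhood of 0, so only the behaviour at infinity limits the Mellin
transform, which exists on all of Re s < 0. -/
theorem fracTail_isBigO_zero {N : ℕ} (hN : 1 ≤ N) (b : ℝ) :
    fracTail N =O[nhdsWithin 0 (Ioi 0)] fun u : ℝ => u ^ (-b) := by
  refine IsBigO.of_bound 1 ?_
  have : ∀ᶠ u : ℝ in nhdsWithin 0 (Ioi 0), u < 1 :=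
    mem_nhdsWithin_of_mem_nhds (Iio_mem_nhds one_pos)
  filter_upwards [this] with u hu
  rw [fracTail_of_le (hu.le.trans (by exact_mod_cast hN)), norm_zero]
  positivity

theorem differentiableAt_mellin_fracTail {N : ℕ} (hN : 1 ≤ N) {s : ℂ} (hs : s.re < 0) :
    DifferentiableAt ℂ (mellin (fracTail N)) s :=
  mellin_differentiableAt_of_isBigO_rpow (a := 0) (b := s.re - 1)
    ((locallyIntegrable_fracTail N).locallyIntegrableOn _) (fracTail_isBigO_atTop N) hs
    (fracTail_isBigO_zero hN _) (by linarith)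

theorem mellinConvergent_fracTail {N : ℕ} (hN : 1 ≤ N) {s : ℂ} (hs : s.re < 0) :
    MellinConvergent (fracTail N) s :=
  mellinConvergent_of_isBigO_rpow (a := 0) (b := s.re - 1)
    ((locallyIntegrable_fracTail N).locallyIntegrableOn _) (fracTail_isBigO_atTop N) hs
    (fracTail_isBigO_zero hN _) (by linarith)

theorem mellin_fracTail (N : ℕ) (s : ℂ) :
    mellin (fracTail N) s = ∫ u in Ioi (N : ℝ), (u : ℂ) ^ (s - 1) * (Int.fract u : ℝ) := by
  have h : ∀ u : ℝ, (u : ℂ) ^ (s - 1) • fracTail N u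
      = (Ioi (N : ℝ)).indicator (fun u : ℝ => (u : ℂ) ^ (s - 1) * (Int.fract u : ℝ)) u := by
    intro u
    unfold fracTail
    by_cases h : u ∈ Ioi (N : ℝ)
    · simp [indicator_of_mem h]
    · simp [indicator_of_notMem h]
  rw [mellin]
  simp_rw [h]
  rw [setIntegral_indicator measurableSet_Ioi, inter_eq_right.mpr]
  exact Ioi_subset_Ioi (Nat.cast_nonneg N)

theorem integrableOn_cpow_mul_fract {N : ℕ} (hN : 1 ≤ N) {s : ℂ} (hs : s.re < 0) :
    IntegrableOn (fun u : ℝ => (u : ℂ) ^ (s - 1) * (Int.fract u : ℝ)) (Ioi (N : ℝ)) := by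
  refine ((mellinConvergent_fracTail hN hs).mono_set
    (Ioi_subset_Ioi (Nat.cast_nonneg N))).congr_fun (fun u hu => ?_) measurableSet_Ioi
  simp [fracTail, indicator_of_mem hu]

/-- Abel summation gives ζ(s) = s ∫_1^∞ ⌊t⌋ t^(−s−1) dt; then ⌊t⌋ = t − {t}. -/
theorem riemannZeta_eq_of_one_lt_re {s : ℂ} (hs : 1 < s.re) :
    riemannZeta s = 1 + 1 / (s - 1) - s * mellin (fracTail 1) (-s) := by
  have hs1 : s - 1 ≠ 0 := fun h => by
    have := congrArg Complex.re h
    simp at this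
    linarith
  have hO : (fun n : ℕ => ∑ k ∈ Finset.Icc 1 n, ‖(1 : ℕ → ℂ) k‖) =O[atTop]
      fun n => (n : ℝ) ^ (1 : ℝ) := by
    simpa using isBigO_refl _ _
  have h := LSeries_eq_mul_integral' (1 : ℕ → ℂ) zero_le_one hs hO
  rw [LSeries_one_eq_riemannZeta hs] at h
  have hI : ∫ t in Ioi (1 : ℝ), (t : ℂ) ^ (-s) = 1 / (s - 1) := by
    rw [integral_Ioi_cpow_of_lt (by simpa using hs) one_pos]
    simp only [Complex.ofReal_one, Complex.one_cpow]
    rw [show -s + 1 = -(s - 1) by ring, neg_div_neg_eq]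
  have hint : IntegrableOn (fun t : ℝ => (t : ℂ) ^ (-s)) (Ioi (1 : ℝ)) :=
    integrableOn_Ioi_cpow_of_lt (by simpa using hs) one_pos
  have hf := integrableOn_cpow_mul_fract le_rfl (s := -s) (by simp; linarith)
  have hm := mellin_fracTail 1 (-s)
  simp only [Nat.cast_one] at hm hf
  have e : ∫ t in Ioi (1 : ℝ), (∑ k ∈ Finset.Icc 1 ⌊t⌋₊, (1 : ℕ → ℂ) k) * (t : ℂ) ^ (-(s + 1))
      = 1 / (s - 1) - mellin (fracTail 1) (-s) := by
    rw [hm, ← hI, ← integral_sub hint hf]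
    refine setIntegral_congr_fun measurableSet_Ioi fun t ht => ?_
    have ht0 : (0 : ℝ) < t := one_pos.trans ht
    have hfl : ((⌊t⌋₊ : ℝ) : ℂ) = t - (Int.fract t : ℝ) := by
      rw [← Complex.ofReal_sub, Int.self_sub_fract, natCast_floor_eq_intCast_floor ht0.le]
    have hp : (t : ℂ) ^ (-s) = t * (t : ℂ) ^ (-s - 1) := by
      rw [Complex.cpow_sub _ _ (by exact_mod_cast ht0.ne'), Complex.cpow_one,
        mul_div_cancel₀ _ (by exact_mod_cast ht0.ne')]
    simp only [Pi.one_apply, Finset.sum_const, Nat.card_Icc, add_tsub_cancel_right, nsmul_eq_mul,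
      mul_one]
    rw [hp, neg_add', show ((⌊t⌋₊ : ℕ) : ℂ) = ((⌊t⌋₊ : ℝ) : ℂ) by simp, hfl]
    ring
  rw [h, e]
  field_simp
  ring

/-- Analytic continuation from Re s > 1. The open quadrant is convex and avoids the pole, and t > 0
is all that is needed on the critical line. -/
theorem riemannZeta_eq_of_pos {s : ℂ} (hs : 0 < s.re) (hi : 0 < s.im) :
    riemannZeta s = 1 + 1 / (s - 1) - s * mellin (fracTail 1) (-s) := by
  set U : Set ℂ := {z | 0 < z.re} ∩ {z | 0 < z.im} with hU
  have hUo : IsOpen U :=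
    (isOpen_lt continuous_const Complex.continuous_re).inter
      (isOpen_lt continuous_const Complex.continuous_im)
  have hUc : IsPreconnected U :=
    ((convex_halfSpace_re_gt 0).inter (convex_halfSpace_im_gt 0)).isPreconnected
  have hne : ∀ z ∈ U, z ≠ 1 := by
    rintro z hz rfl
    simpa using hz.2
  have h1 : AnalyticOnNhd ℂ riemannZeta U := DifferentiableOn.analyticOnNhd
    (fun z hz => (differentiableAt_riemannZeta (hne z hz)).differentiableWithinAt) hUo
  have h2 : AnalyticOnNhd ℂ (fun s => 1 + 1 / (s - 1) - s * mellin (fracTail 1) (-s)) U := by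
    refine DifferentiableOn.analyticOnNhd (fun z hz => ?_) hUo
    have hm : DifferentiableAt ℂ (fun s => mellin (fracTail 1) (-s)) z :=
      (differentiableAt_mellin_fracTail le_rfl (s := -z) (by simpa using hz.1)).comp z
        differentiableAt_id.neg
    have hz1 : z - 1 ≠ 0 := sub_ne_zero.mpr (hne z hz)
    exact (DifferentiableAt.sub (by fun_prop (disch := exact hz1))
      (differentiableAt_id.mul hm)).differentiableWithinAt
  refine h1.eqOn_of_preconnected_of_eventuallyEq h2 hUc (z₀ := 2 + Complex.I)
    (by simp [hU]) ?_ ⟨hs, hi⟩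
  have : {z : ℂ | 1 < z.re} ∈ nhds (2 + Complex.I) :=
    (isOpen_lt continuous_const Complex.continuous_re).mem_nhds (by simp)
  filter_upwards [this] with z hz using riemannZeta_eq_of_one_lt_re hz

/-- On (N, N+1) one has {u} = u − N, so this piece of the tail is an elementary integral. It is the
induction step of the Euler–Maclaurin formula. -/
theorem mellin_fracTail_succ {N : ℕ} (hN : 1 ≤ N) {s : ℂ} (hs : 0 < s.re) (hs1 : s ≠ 1) :
    s * mellin (fracTail N) (-s) = s * mellin (fracTail (N + 1)) (-s)
      + s / (1 - s) * (((N + 1 : ℕ) : ℂ) ^ (1 - s) - (N : ℂ) ^ (1 - s))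
      + N * (((N + 1 : ℕ) : ℂ) ^ (-s) - (N : ℂ) ^ (-s)) := by
  have hs0 : s ≠ 0 := fun h => by simp [h] at hs
  have h1s : 1 - s ≠ 0 := sub_ne_zero.mpr hs1.symm
  have hNpos : (0 : ℝ) < N := by exact_mod_cast hN
  have hle : (N : ℝ) ≤ ((N + 1 : ℕ) : ℝ) := by push_cast; linarith
  have hint := integrableOn_cpow_mul_fract hN (s := -s) (by simpa using hs)
  have hsplit : ∫ u in Ioi (N : ℝ), (u : ℂ) ^ (-s - 1) * (Int.fract u : ℝ)
      = (∫ u in Ioc (N : ℝ) ((N + 1 : ℕ) : ℝ), (u : ℂ) ^ (-s - 1) * (Int.fract u : ℝ))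
        + ∫ u in Ioi ((N + 1 : ℕ) : ℝ), (u : ℂ) ^ (-s - 1) * (Int.fract u : ℝ) := by
    rw [← Ioc_union_Ioi_eq_Ioi hle]
    exact setIntegral_union (Ioc_disjoint_Ioi le_rfl) measurableSet_Ioi
      (hint.mono_set (Ioc_subset_Ioi_self)) (hint.mono_set (Ioi_subset_Ioi hle))
  have hcongr : ∫ u in Ioc (N : ℝ) ((N + 1 : ℕ) : ℝ), (u : ℂ) ^ (-s - 1) * (Int.fract u : ℝ)
      = ∫ u in (N : ℝ)..((N + 1 : ℕ) : ℝ), ((u : ℂ) ^ (-s) - N * (u : ℂ) ^ (-s - 1)) := by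
    -- The right endpoint is discarded because ⌊u⌋ jumps to N + 1 there.
    rw [intervalIntegral.integral_of_le hle, integral_Ioc_eq_integral_Ioo,
      integral_Ioc_eq_integral_Ioo]
    refine setIntegral_congr_fun measurableSet_Ioo fun u hu => ?_
    have hu0 : (0 : ℝ) < u := hNpos.trans hu.1
    have hfl : ⌊u⌋ = (N : ℤ) := by
      rw [Int.floor_eq_iff]
      refine ⟨by exact_mod_cast hu.1.le, ?_⟩
      have := hu.2
      push_cast at this ⊢
      exact this
    have hp : (u : ℂ) ^ (-s) = u * (u : ℂ) ^ (-s - 1) := by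
      rw [Complex.cpow_sub _ _ (by exact_mod_cast hu0.ne'), Complex.cpow_one,
        mul_div_cancel₀ _ (by exact_mod_cast hu0.ne')]
    simp only [Int.fract, hfl, hp]
    push_cast
    ring
  have h0 : (0 : ℝ) ∉ uIcc (N : ℝ) ((N + 1 : ℕ) : ℝ) := by
    rw [uIcc_of_le hle]
    exact fun h => absurd h.1 (not_le.mpr hNpos)
  have hi1 : IntervalIntegrable (fun u : ℝ => (u : ℂ) ^ (-s)) volume N ((N + 1 : ℕ) : ℝ) :=
    intervalIntegral.intervalIntegrable_cpow (Or.inr h0)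
  have hi2 : IntervalIntegrable (fun u : ℝ => (N : ℂ) * (u : ℂ) ^ (-s - 1)) volume N
      ((N + 1 : ℕ) : ℝ) :=
    (intervalIntegral.intervalIntegrable_cpow (Or.inr h0)).const_mul _
  have hval : ∫ u in (N : ℝ)..((N + 1 : ℕ) : ℝ), ((u : ℂ) ^ (-s) - N * (u : ℂ) ^ (-s - 1))
      = (((N + 1 : ℕ) : ℂ) ^ (1 - s) - (N : ℂ) ^ (1 - s)) / (1 - s)
        + N * (((N + 1 : ℕ) : ℂ) ^ (-s) - (N : ℂ) ^ (-s)) / s := by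
    rw [intervalIntegral.integral_sub hi1 hi2, intervalIntegral.integral_const_mul,
      integral_cpow (Or.inr ⟨fun h => hs1 (neg_injective h), h0⟩),
      integral_cpow (Or.inr ⟨fun h => hs0 (by simpa using h), h0⟩)]
    have e1 : -s + 1 = 1 - s := by ring
    have e2 : -s - 1 + 1 = -s := by ring
    rw [e1, e2]
    simp only [Complex.ofReal_natCast]
    rw [div_neg]
    ring
  rw [mellin_fracTail, mellin_fracTail, hsplit, hcongr, hval]
  field_simp
  ring

/-- The Euler–Maclaurin formula of first order for `ζ` on the upper half of `Re s > 0`. -/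
theorem riemannZeta_eq_sum_add {N : ℕ} (hN : 1 ≤ N) {s : ℂ} (hs : 0 < s.re) (hi : 0 < s.im) :
    riemannZeta s = ∑ n ∈ Finset.Icc 1 N, (n : ℂ) ^ (-s)
      + ((N : ℂ) ^ (1 - s) / (s - 1) - s * mellin (fracTail N) (-s)) := by
  have hs1 : s ≠ 1 := by
    rintro rfl
    simp at hi
  have h1s : 1 - s ≠ 0 := sub_ne_zero.mpr hs1.symm
  have hs1' : s - 1 ≠ 0 := sub_ne_zero.mpr hs1
  induction N, hN using Nat.le_induction with
  | base => simp [riemannZeta_eq_of_pos hs hi]; ring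
  | succ N hN ih =>
    have hb : (N : ℂ) ^ (1 - s) = N * (N : ℂ) ^ (-s) := by
      rw [sub_eq_add_neg, Complex.cpow_add _ _ (by exact_mod_cast (by omega : N ≠ 0)),
        Complex.cpow_one]
    have ha : ((N + 1 : ℕ) : ℂ) ^ (1 - s) = (N + 1 : ℕ) * ((N + 1 : ℕ) : ℂ) ^ (-s) := by
      rw [sub_eq_add_neg, Complex.cpow_add _ _ (by exact_mod_cast (by omega : N + 1 ≠ 0)),
        Complex.cpow_one]
    have hc : s / (1 - s) = -(1 / (s - 1)) - 1 := by
      rw [← neg_sub s 1]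
      field_simp
      ring
    rw [ih, mellin_fracTail_succ hN hs hs1, Finset.sum_Icc_succ_top (by omega), hc]
    have hb' : (N : ℂ) * (N : ℂ) ^ (-s) = (N : ℂ) ^ (1 - s) := hb.symm
    have ha' : (N : ℂ) * ((N + 1 : ℕ) : ℂ) ^ (-s)
        = ((N + 1 : ℕ) : ℂ) ^ (1 - s) - ((N + 1 : ℕ) : ℂ) ^ (-s) := by
      rw [ha]; push_cast; ring
    rw [mul_sub (N : ℂ), hb', ha']
    ring

/-- The tail integral `∫_N^∞ {u} u^(-s-1) du` at `s = 1/2 + it`. -/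
noncomputable def tailIntegral (N : ℕ) (t : ℝ) : ℂ :=
  mellin (fracTail N) (-(1 / 2 + Complex.I * t))

theorem norm_tailIntegral_one_le (t : ℝ) : ‖tailIntegral 1 t‖ ≤ 2 := by
  have h : ∫ u in Ioi (1 : ℝ), u ^ (-(3 / 2) : ℝ) = 2 := by
    rw [integral_Ioi_rpow_of_lt (by norm_num) one_pos]
    norm_num
  rw [tailIntegral, mellin_fracTail, ← h, Nat.cast_one]
  refine norm_integral_le_of_norm_le (integrableOn_Ioi_rpow_of_lt (by norm_num) one_pos) ?_
  refine (ae_restrict_iff' measurableSet_Ioi).mpr (.of_forall fun u hu => ?_)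
  have hu0 : (0 : ℝ) < u := one_pos.trans hu
  rw [norm_mul, Complex.norm_cpow_eq_rpow_re_of_pos hu0, Complex.norm_real,
    Real.norm_of_nonneg (Int.fract_nonneg u)]
  have : (-(1 / 2 + Complex.I * (t : ℂ)) - 1).re = -(3 / 2) := by simp; norm_num
  rw [this]
  exact mul_le_of_le_one_right (by positivity) (Int.fract_lt_one u).le

/-- The substitution u = e^(−v), which turns the Mellin transform into a Fourier transform, moves
the cut-off u > N to v < −ln N. -/
theorem norm_exp_smul_fracTail_sq_le {N : ℕ} (hN : 1 ≤ N) (v : ℝ) :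
    ‖Real.exp (1 / 2 * v) • fracTail N (Real.exp (-v))‖ ≤
      (Iio (-Real.log N)).indicator (fun v => Real.exp (1 / 2 * v)) v := by
  have hNpos : (0 : ℝ) < N := by exact_mod_cast hN
  by_cases h : v ∈ Iio (-Real.log N)
  · rw [indicator_of_mem h, norm_smul, Real.norm_of_nonneg (Real.exp_pos _).le]
    exact mul_le_of_le_one_right (Real.exp_pos _).le (norm_fracTail_le_one _ _)
  · rw [indicator_of_notMem h, fracTail_of_le, smul_zero, norm_zero]
    rw [← Real.exp_log hNpos]
    exact Real.exp_le_exp.mpr (by simp at h; linarith)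

/-- Mean square bound for the tail integral on the critical line. -/
theorem integral_norm_sq_tailIntegral_le {N : ℕ} (hN : 1 ≤ N) :
    Integrable (fun t => ‖tailIntegral N t‖ ^ 2) ∧
      ∫ t, ‖tailIntegral N t‖ ^ 2 ≤ 2 * Real.pi / N := by
  have hNpos : (0 : ℝ) < N := by exact_mod_cast hN
  set g : ℝ → ℂ := fun v => Real.exp (1 / 2 * v) • fracTail N (Real.exp (-v)) with hg
  have hgm : AEStronglyMeasurable g := by
    refine AEStronglyMeasurable.smul (f := fun v : ℝ => Real.exp (1 / 2 * v))
      (Continuous.aestronglyMeasurable (by fun_prop)) ?_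
    exact ((measurable_fracTail N).comp (by fun_prop)).aestronglyMeasurable
  have hexp : ∀ c : ℝ, 0 < c → Integrable
      ((Iio (-Real.log N)).indicator fun v : ℝ => Real.exp (c * v)) := fun c hc =>
    (integrable_indicator_iff measurableSet_Iio).mpr
      ((integrableOn_exp_mul_Iic hc _).mono_set Iio_subset_Iic_self)
  have hb := norm_exp_smul_fracTail_sq_le hN
  have hb2 : ∀ v, ‖g v‖ ^ 2 ≤ (Iio (-Real.log N)).indicator (fun v => Real.exp (1 * v)) v := by
    intro v
    refine (pow_le_pow_left₀ (norm_nonneg _) (hb v) 2).trans_eq ?_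
    by_cases h : v ∈ Iio (-Real.log N)
    · rw [indicator_of_mem h, indicator_of_mem h, ← Real.exp_nat_mul]
      congr 1
      push_cast
      ring
    · simp [indicator_of_notMem h]
  have h1 : Integrable g := (hexp (1 / 2) (by norm_num)).mono' hgm (.of_forall hb)
  have h2' : Integrable fun v => ‖g v‖ ^ 2 :=
    (hexp 1 one_pos).mono' (hgm.norm.pow 2) (.of_forall fun v => by simpa using hb2 v)
  have h2 : MemLp g 2 := (memLp_two_iff_integrable_sq_norm hgm).mpr h2'
  -- The rescaling of the frequency is the source of the factor 2π in the bound.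
  have hfour : ∀ t, tailIntegral N t = FourierTransform.fourier g (-(2 * Real.pi)⁻¹ * t) := by
    intro t
    rw [tailIntegral, mellin_eq_fourier]
    have e1 : (-(1 / 2 + Complex.I * (t : ℂ))).re = -(1 / 2) := by simp
    have e2 : (-(1 / 2 + Complex.I * (t : ℂ))).im = -t := by simp
    rw [e1, e2, neg_neg, show -t / (2 * Real.pi) = -(2 * Real.pi)⁻¹ * t by ring]
  have hpi : -(2 * Real.pi)⁻¹ ≠ 0 := neg_ne_zero.mpr (inv_ne_zero (by positivity))
  simp_rw [hfour]
  refine ⟨(integrable_norm_sq_fourier h1 h2).comp_mul_left' hpi, ?_⟩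
  rw [Measure.integral_comp_mul_left (fun y => ‖FourierTransform.fourier g y‖ ^ 2),
    integral_norm_sq_fourier_eq h1 h2]
  -- The integral of e^v over v < −ln N equals 1/N.
  have : ∫ v, ‖g v‖ ^ 2 ≤ 1 / N := by
    refine (integral_mono h2' (hexp 1 one_pos) hb2).trans_eq ?_
    rw [integral_indicator measurableSet_Iio, ← integral_Iic_eq_integral_Iio,
      integral_exp_mul_Iic one_pos, one_mul, Real.exp_neg, Real.exp_log hNpos]
    simp
  rw [inv_neg, inv_inv, abs_neg, abs_of_pos (by positivity), smul_eq_mul, mul_div_assoc,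
    ← mul_one_div]
  calc 2 * Real.pi * ∫ v, ‖g v‖ ^ 2 ≤ 2 * Real.pi * (1 / N) := by gcongr
    _ = _ := by ring

end JacobLadder

/-! ### Growth of ζ on the critical line, its zeros, and Laplace integrals -/

namespace JacobLadder

theorem half_add_I_mul_ne_one (t : ℝ) : (1 / 2 + Complex.I * t : ℂ) ≠ 1 := fun h => by
  have := congrArg Complex.re h
  norm_num at this

theorem continuous_riemannZeta_half : Continuous fun t : ℝ => riemannZeta (1 / 2 + Complex.I * t) :=
  continuous_iff_continuousAt.mpr fun t =>
    (differentiableAt_riemannZeta (half_add_I_mul_ne_one t)).continuousAt.comp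
      (f := fun t : ℝ => (1 / 2 + Complex.I * t : ℂ)) (by fun_prop)

theorem continuous_hardyZ_sq : Continuous fun t => hardyZ t ^ 2 := by
  simp_rw [hardyZ_sq]
  exact continuous_riemannZeta_half.norm.pow 2

/-- The zeros of ζ form a closed discrete subset of a Lindelöf space. Strict monotonicity of the
integrals and positivity of the weights almost everywhere rest on this. -/
theorem countable_hardyZ_zeros : {t | hardyZ t ^ 2 = 0}.Countable := by
  have h : riemannZetaZeros.Countable :=
    isClosed_riemannZetaZeros.isLindelof.countable_of_isDiscrete isDiscrete_riemannZetaZeros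
  refine (h.preimage_of_injOn (f := fun t : ℝ => (1 / 2 + Complex.I * t : ℂ)) ?_).mono ?_
  · intro a _ b _ hab
    simpa using hab
  · intro t ht
    have ht' : hardyZ t ^ 2 = 0 := ht
    rw [hardyZ_sq] at ht'
    simpa [mem_riemannZetaZeros] using ht'

theorem norm_half_add_I_mul_sq (t : ℝ) : ‖(1 / 2 + Complex.I * t : ℂ)‖ ^ 2 = 1 / 4 + t ^ 2 := by
  rw [← Complex.normSq_eq_norm_sq, Complex.normSq_apply]
  simp
  ring

theorem norm_half_add_I_mul_sub_one_sq (t : ℝ) :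
    ‖(1 / 2 + Complex.I * t - 1 : ℂ)‖ ^ 2 = 1 / 4 + t ^ 2 := by
  rw [← Complex.normSq_eq_norm_sq, Complex.normSq_apply]
  simp
  ring

/-- Euler–Maclaurin with N = 1. Any polynomial bound would serve: it makes the exponentially
weighted integrals converge and the boundary term of S' negligible. -/
theorem norm_riemannZeta_half_le {t : ℝ} (ht : 0 < t) :
    ‖riemannZeta (1 / 2 + Complex.I * t)‖ ≤ 4 * (1 + t) := by
  have h := riemannZeta_eq_of_pos (s := 1 / 2 + Complex.I * t) (by simp) (by simpa using ht)
  have h1 := norm_tailIntegral_one_le t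
  have h2 : 1 / 2 ≤ ‖(1 / 2 + Complex.I * t - 1 : ℂ)‖ := by
    refine le_of_sq_le_sq ?_ (norm_nonneg _)
    rw [norm_half_add_I_mul_sub_one_sq]
    nlinarith
  have h3 : ‖(1 / 2 + Complex.I * t : ℂ)‖ ≤ 1 / 2 + t := by
    refine le_of_sq_le_sq ?_ (by positivity)
    rw [norm_half_add_I_mul_sq]
    nlinarith
  rw [h]
  refine (norm_sub_le _ _).trans ?_
  have h4 : ‖1 + 1 / (1 / 2 + Complex.I * t - 1 : ℂ)‖ ≤ 1 + 2 := by
    refine (norm_add_le _ _).trans ?_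
    rw [norm_one, norm_div, norm_one]
    gcongr
    rw [div_le_iff₀ (by linarith)]
    linarith
  have h5 : ‖(1 / 2 + Complex.I * t : ℂ) * mellin (fracTail 1) (-(1 / 2 + Complex.I * t))‖
      ≤ (1 / 2 + t) * 2 := by
    rw [norm_mul]
    gcongr
    exact h1
  linarith

theorem hardyZ_sq_le {t : ℝ} (ht : 0 < t) : hardyZ t ^ 2 ≤ 16 * (1 + t) ^ 2 := by
  rw [hardyZ_sq, show 16 * (1 + t) ^ 2 = (4 * (1 + t)) ^ 2 by ring]
  exact pow_le_pow_left₀ (norm_nonneg _) (norm_riemannZeta_half_le ht) 2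

/-- Polynomial growth against an exponential weight. -/
theorem integrableOn_mul_exp_neg {F : ℝ → ℝ} (hF : Continuous F) {C : ℝ} {k : ℕ}
    (hC : ∀ t, 0 < t → |F t| ≤ C * (1 + t) ^ k) {c : ℝ} (hc : 0 < c) :
    IntegrableOn (fun t => F t * Real.exp (-c * t)) (Ioi 0) := by
  -- Half of the exponential decay is spent on absorbing the polynomial.
  refine integrable_of_isBigO_exp_neg (b := c / 2) (by positivity)
    (hF.mul (by fun_prop)).continuousOn ?_
  have h1 : F =O[atTop] fun t => (1 + t) ^ k := by
    refine IsBigO.of_bound C ?_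
    filter_upwards [eventually_gt_atTop 0] with t ht
    rw [Real.norm_eq_abs, Real.norm_of_nonneg (by positivity)]
    exact hC t ht
  have h2 : (fun t : ℝ => (1 + t) ^ k) =O[atTop] fun t => Real.exp (c / 2 * t) := by
    have h := (isLittleO_pow_exp_pos_mul_atTop k (half_pos hc)).isBigO.comp_tendsto
      (tendsto_atTop_add_const_left atTop (1 : ℝ) tendsto_id)
    refine h.trans (IsBigO.of_bound (Real.exp (c / 2)) (.of_forall fun t => ?_))
    simp only [Function.comp_apply, id, Real.norm_eq_abs, Real.abs_exp, ← Real.exp_add]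
    exact le_of_eq (by ring_nf)
  refine ((h1.trans h2).mul (isBigO_refl (fun t => Real.exp (-c * t)) atTop)).congr_right ?_
  intro t
  rw [← Real.exp_add]
  ring_nf

theorem integrableOn_moment {c : ℝ} (hc : 0 < c) :
    IntegrableOn (fun t => t * hardyZ t ^ 2 * Real.exp (-c * t)) (Ioi 0) := by
  refine integrableOn_mul_exp_neg (C := 16) (k := 3) (continuous_id.mul continuous_hardyZ_sq)
    (fun t ht => ?_) hc
  simp only [Pi.mul_apply, id]
  rw [abs_of_nonneg (mul_nonneg ht.le (sq_nonneg _))]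
  calc t * hardyZ t ^ 2 ≤ (1 + t) * (16 * (1 + t) ^ 2) := by
        gcongr
        · linarith
        · exact hardyZ_sq_le ht
    _ = _ := by ring

/-- The Dirichlet polynomial `∑_{n ≤ N} n^(-1/2-it)`. -/
noncomputable def dirichletPoly (N : ℕ) (t : ℝ) : ℂ :=
  ∑ n ∈ Finset.Icc 1 N, (n : ℂ) ^ (-(1 / 2 + Complex.I * t))

theorem natCast_cpow_eq {n : ℕ} (hn : 1 ≤ n) (t : ℝ) :
    (n : ℂ) ^ (-(1 / 2 + Complex.I * t) : ℂ)
      = ((1 / √n : ℝ) : ℂ) * Complex.exp (-(Complex.I * t * Real.log n)) := by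
  have hn0 : (0 : ℝ) < n := by exact_mod_cast hn
  rw [Complex.cpow_def_of_ne_zero (by exact_mod_cast hn0.ne'), Complex.natCast_log,
    mul_neg, mul_add, neg_add, Complex.exp_add]
  congr 1
  · rw [Real.sqrt_eq_rpow, one_div (_ ^ _ : ℝ), ← Real.rpow_neg hn0.le, Real.rpow_def_of_pos hn0]
    push_cast
    congr 1
    ring
  · congr 1
    ring

theorem continuous_dirichletPoly (N : ℕ) : Continuous (dirichletPoly N) := by
  refine continuous_finsetSum _ fun n hn => ?_
  simp_rw [natCast_cpow_eq (Finset.mem_Icc.mp hn).1]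
  fun_prop

theorem norm_dirichletPoly_le (N : ℕ) (t : ℝ) : ‖dirichletPoly N t‖ ≤ N := by
  refine (norm_sum_le _ _).trans ?_
  refine (Finset.sum_le_card_nsmul _ _ 1 fun n hn => ?_).trans (by simp)
  have hn1 := (Finset.mem_Icc.mp hn).1
  have hn0 : (0 : ℝ) < n := by exact_mod_cast hn1
  rw [Complex.norm_natCast_cpow_of_pos hn1]
  simp only [Complex.neg_re, Complex.add_re, Complex.div_ofNat_re, Complex.one_re, Complex.mul_re,
    Complex.I_re, Complex.I_im, Complex.ofReal_re, Complex.ofReal_im]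
  exact Real.rpow_le_one_of_one_le_of_nonpos (by exact_mod_cast hn1) (by norm_num)

theorem integrableOn_mul_exp_neg_complex {c : ℝ} (hc : 0 < c) (y : ℝ) :
    IntegrableOn (fun t : ℝ => (t : ℂ) * Complex.exp (-(c + Complex.I * y) * t)) (Ioi 0) := by
  have h := integrableOn_mul_exp_neg (F := fun t => t) continuous_id (C := 1) (k := 1)
    (fun t ht => by rw [abs_of_pos ht]; linarith) hc
  refine Integrable.mono' h (Continuous.aestronglyMeasurable (by fun_prop)) ?_
  refine (ae_restrict_iff' measurableSet_Ioi).mpr (.of_forall fun t ht => ?_)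
  rw [norm_mul, Complex.norm_exp, Complex.norm_real, Real.norm_of_nonneg (le_of_lt ht)]
  simp

/-- An antiderivative is −(t/r + 1/r²) e^(−rt) with r = c + iy. The factor t yields 1/r² in place of
1/r, so the off-diagonal terms can be summed in absolute value. -/
theorem integral_mul_exp_neg_complex {c : ℝ} (hc : 0 < c) (y : ℝ) :
    ∫ t in Ioi (0 : ℝ), (t : ℂ) * Complex.exp (-(c + Complex.I * y) * t)
      = (1 / (c + Complex.I * y)) ^ 2 := by
  have hr : (c + Complex.I * y : ℂ) ≠ 0 := fun h => by
    have := congrArg Complex.re h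
    simp at this
    exact hc.ne' this
  have hint := integrableOn_mul_exp_neg_complex hc y
  have hnorm : ∀ t : ℝ, ‖Complex.exp (-(c + Complex.I * y) * t)‖ = Real.exp (-c * t) := fun t => by
    rw [Complex.norm_exp]
    simp
  set r : ℂ := c + Complex.I * y with hrdef
  have hd : ∀ t : ℝ, HasDerivAt (fun t : ℝ => -((t : ℂ) / r + 1 / r ^ 2) * Complex.exp (-r * t))
      ((t : ℂ) * Complex.exp (-r * t)) t := by
    intro t
    have h1 : HasDerivAt (fun t : ℝ => (t : ℂ)) 1 t := Complex.ofRealCLM.hasDerivAt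
    have h2 := ((h1.div_const r).add_const (1 / r ^ 2)).neg
    have h3 := (h1.const_mul (-r)).cexp
    refine (h2.mul h3).congr_deriv ?_
    simp only [Pi.neg_apply]
    field_simp
    ring
  have ht : Tendsto (fun t : ℝ => -((t : ℂ) / r + 1 / r ^ 2) * Complex.exp (-r * t)) atTop
      (nhds 0) := by
    have h1 : Tendsto (fun t : ℝ => t ^ 1 * Real.exp (-c * t)) atTop (nhds 0) := by
      simpa using Real.tendsto_pow_mul_exp_neg_atTop_nhds_zero 1 |>.comp
        (tendsto_id.const_mul_atTop hc) |>.const_mul (1 / c) |>.congr (fun t => by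
          simp only [Function.comp_apply, id]
          field_simp)
    have h2 : Tendsto (fun t : ℝ => Real.exp (-c * t)) atTop (nhds 0) :=
      Real.tendsto_exp_atBot.comp (tendsto_id.const_mul_atTop_of_neg (neg_neg_of_pos hc))
    have h3 := (h1.const_mul (1 / ‖r‖)).add (h2.const_mul ‖1 / r ^ 2‖)
    rw [mul_zero, mul_zero, add_zero] at h3
    refine squeeze_zero_norm' ?_ h3
    filter_upwards [eventually_ge_atTop 0] with t ht
    rw [norm_mul, hnorm, norm_neg]
    calc ‖(t : ℂ) / r + 1 / r ^ 2‖ * Real.exp (-c * t)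
        ≤ (t / ‖r‖ + ‖1 / r ^ 2‖) * Real.exp (-c * t) := by
          gcongr
          refine (norm_add_le _ _).trans_eq ?_
          rw [norm_div, Complex.norm_real, Real.norm_of_nonneg ht]
      _ = _ := by ring
  rw [integral_Ioi_of_hasDerivAt_of_tendsto' (fun t _ => hd t) hint ht]
  simp

end JacobLadder

/-! ### Moments of the Dirichlet polynomial and of the remainder -/

namespace JacobLadder

theorem norm_dirichletPoly_sq (N : ℕ) (t : ℝ) :
    ((‖dirichletPoly N t‖ ^ 2 : ℝ) : ℂ) = ∑ n ∈ Finset.Icc 1 N, ∑ m ∈ Finset.Icc 1 N,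
      ((1 / √n * (1 / √m) : ℝ) : ℂ)
        * Complex.exp (-(Complex.I * ((Real.log n - Real.log m : ℝ) : ℂ)) * t) := by
  push_cast
  rw [← Complex.mul_conj', dirichletPoly, map_sum, Finset.sum_mul_sum]
  refine Finset.sum_congr rfl fun n hn => Finset.sum_congr rfl fun m hm => ?_
  rw [natCast_cpow_eq (Finset.mem_Icc.mp hn).1, natCast_cpow_eq (Finset.mem_Icc.mp hm).1,
    map_mul, Complex.conj_ofReal, ← Complex.exp_conj, mul_mul_mul_comm, ← Complex.exp_add]
  congr 1
  · push_cast; rfl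
  · congr 1
    simp only [map_neg, map_mul, Complex.conj_I, Complex.conj_ofReal]
    simp only [Complex.natCast_log]
    ring

/-- The weighted mean square of the Dirichlet polynomial as a double sum. -/
theorem integral_norm_dirichletPoly_sq (N : ℕ) {c : ℝ} (hc : 0 < c) :
    ((∫ t in Ioi (0 : ℝ), t * ‖dirichletPoly N t‖ ^ 2 * Real.exp (-c * t) : ℝ) : ℂ)
      = ∑ n ∈ Finset.Icc 1 N, ∑ m ∈ Finset.Icc 1 N, ((1 / √n * (1 / √m) : ℝ) : ℂ)
        * (1 / (c + Complex.I * ((Real.log n - Real.log m : ℝ) : ℂ))) ^ 2 := by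
  have h : ∀ t : ℝ, ((t * ‖dirichletPoly N t‖ ^ 2 * Real.exp (-c * t) : ℝ) : ℂ)
      = ∑ n ∈ Finset.Icc 1 N, ∑ m ∈ Finset.Icc 1 N, ((1 / √n * (1 / √m) : ℝ) : ℂ)
        * ((t : ℂ) * Complex.exp (-(c + Complex.I * ((Real.log n - Real.log m : ℝ) : ℂ)) * t)) := by
    intro t
    rw [Complex.ofReal_mul, Complex.ofReal_mul, norm_dirichletPoly_sq, Finset.mul_sum,
      Finset.sum_mul]
    refine Finset.sum_congr rfl fun n _ => ?_
    rw [Finset.mul_sum, Finset.sum_mul]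
    refine Finset.sum_congr rfl fun m _ => ?_
    rw [neg_add, add_mul, Complex.exp_add, Complex.ofReal_exp]
    push_cast
    ring
  have hint : ∀ n m : ℕ, IntegrableOn (fun t : ℝ => ((1 / √n * (1 / √m) : ℝ) : ℂ)
        * ((t : ℂ) * Complex.exp (-(c + Complex.I * ((Real.log n - Real.log m : ℝ) : ℂ)) * t)))
      (Ioi 0) := fun n m => (integrableOn_mul_exp_neg_complex hc _).const_mul _
  rw [← integral_complex_ofReal]
  simp_rw [h]
  rw [integral_finsetSum _ fun n _ => integrable_finsetSum _ fun m _ => hint n m]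
  refine Finset.sum_congr rfl fun n _ => ?_
  rw [integral_finsetSum _ fun m _ => hint n m]
  refine Finset.sum_congr rfl fun m _ => ?_
  rw [integral_const_mul, integral_mul_exp_neg_complex hc]

theorem sub_div_add_le_log_sub {a b : ℝ} (ha : 0 < a) (hab : a ≤ b) :
    (b - a) / (b + a) ≤ Real.log b - Real.log a := by
  have hb := ha.trans_le hab
  rw [← Real.log_div hb.ne' ha.ne']
  refine le_trans ?_ (Real.one_sub_inv_le_log_of_pos (div_pos hb ha))
  rw [inv_div, one_sub_div hb.ne']
  exact div_le_div_of_nonneg_left (by linarith) hb (by linarith)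

theorem sq_div_le_log_sub_sq {a b : ℝ} (ha : 0 < a) (hb : 0 < b) :
    (a - b) ^ 2 / (a + b) ^ 2 ≤ (Real.log a - Real.log b) ^ 2 := by
  rw [← div_pow]
  rcases le_total a b with h | h
  · have h1 := sub_div_add_le_log_sub ha h
    have h2 : 0 ≤ (b - a) / (b + a) := div_nonneg (by linarith) (by linarith)
    calc ((a - b) / (a + b)) ^ 2 = ((b - a) / (b + a)) ^ 2 := by
          rw [add_comm b a, ← neg_sub b a, neg_div, neg_sq]
      _ ≤ (Real.log b - Real.log a) ^ 2 := pow_le_pow_left₀ h2 h1 2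
      _ = _ := by ring
  · exact pow_le_pow_left₀ (div_nonneg (by linarith) (by linarith)) (sub_div_add_le_log_sub hb h) 2

/-- Discarding c leaves |ln n − ln m| ≥ |n − m|/(n + m). With r = √(nm) and (n + m)² = (n − m)² +
4r² the bound becomes 1/r + 4r/(n − m)², and 1 ≤ r ≤ N. It is uniform in c. -/
theorem norm_offDiagonal_le {N n m : ℕ} (hn : n ∈ Finset.Icc 1 N) (hm : m ∈ Finset.Icc 1 N)
    (hnm : n ≠ m) (c : ℝ) :
    ‖((1 / √n * (1 / √m) : ℝ) : ℂ)
        * (1 / (c + Complex.I * ((Real.log n - Real.log m : ℝ) : ℂ))) ^ 2‖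
      ≤ 1 + 4 * N * (1 / (((n : ℤ) - m : ℤ) : ℝ) ^ 2) := by
  obtain ⟨hn1, hnN⟩ := Finset.mem_Icc.mp hn
  obtain ⟨hm1, hmN⟩ := Finset.mem_Icc.mp hm
  have hn1' : (1 : ℝ) ≤ n := by exact_mod_cast hn1
  have hm1' : (1 : ℝ) ≤ m := by exact_mod_cast hm1
  have hnN' : (n : ℝ) ≤ N := by exact_mod_cast hnN
  have hmN' : (m : ℝ) ≤ N := by exact_mod_cast hmN
  have hne : ((n : ℝ) - m) ≠ 0 := sub_ne_zero.mpr (by exact_mod_cast hnm)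
  set r : ℝ := √n * √m with hr
  have hr1 : 1 ≤ r := one_le_mul_of_one_le_of_one_le (Real.one_le_sqrt.mpr hn1')
    (Real.one_le_sqrt.mpr hm1')
  have hr2 : r ^ 2 = n * m := by
    rw [hr, mul_pow, Real.sq_sqrt (by linarith), Real.sq_sqrt (by linarith)]
  have hrN : r ≤ N := by
    refine le_of_sq_le_sq ?_ (by linarith)
    rw [hr2]
    nlinarith
  set y : ℝ := Real.log n - Real.log m with hy
  have hy1 : ((n : ℝ) - m) ^ 2 / (n + m) ^ 2 ≤ y ^ 2 :=
    sq_div_le_log_sub_sq (by linarith) (by linarith)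
  have hpos : 0 < ((n : ℝ) - m) ^ 2 / (n + m) ^ 2 := by positivity
  have hnorm : ‖(c + Complex.I * (y : ℂ) : ℂ)‖ ^ 2 = c ^ 2 + y ^ 2 := by
    rw [← Complex.normSq_eq_norm_sq, Complex.normSq_apply]
    simp
    ring
  rw [norm_mul, norm_pow, norm_div, norm_one, Complex.norm_real, div_pow, hnorm, one_pow,
    Real.norm_of_nonneg (by positivity)]
  calc 1 / √n * (1 / √m) * (1 / (c ^ 2 + y ^ 2))
      ≤ 1 / r * (1 / (((n : ℝ) - m) ^ 2 / (n + m) ^ 2)) := by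
        rw [div_mul_div_comm, one_mul]
        gcongr
        nlinarith
    _ = 1 / r * (1 + 4 * r ^ 2 * (1 / ((n : ℝ) - m) ^ 2)) := by
        rw [hr2]
        congr 1
        field_simp
        ring
    _ = 1 / r + 4 * r * (1 / ((n : ℝ) - m) ^ 2) := by
        field_simp
    _ ≤ 1 + 4 * N * (1 / ((n : ℝ) - m) ^ 2) := by
        gcongr
        rw [div_le_one (by linarith)]
        exact hr1
    _ = _ := by push_cast; rfl

/-- The differences n − m are distinct integers; the term m = n is 1/0 = 0. -/
theorem sum_one_div_sub_sq_le (N n : ℕ) :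
    ∑ m ∈ Finset.Icc 1 N, 1 / (((n : ℤ) - m : ℤ) : ℝ) ^ 2 ≤ ∑' k : ℤ, 1 / (k : ℝ) ^ 2 := by
  have hs : Summable fun k : ℤ => 1 / (k : ℝ) ^ 2 :=
    Real.summable_one_div_int_pow.mpr one_lt_two
  have h := hs.sum_le_tsum ((Finset.Icc 1 N).image fun m : ℕ => (n : ℤ) - m)
    fun k _ => by positivity
  rwa [Finset.sum_image fun a _ b _ hab => by simpa using hab] at h

/-- The diagonal contributes exactly `harmonic N` / c², and each of the N rows of the off-diagonal
part is O(N). For c = 2/x and N = ⌈x⌉ the error lacks the logarithm of the main term. -/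
theorem abs_integral_dirichletPoly_sub_le (N : ℕ) {c : ℝ} (hc : 0 < c) :
    |(∫ t in Ioi (0 : ℝ), t * ‖dirichletPoly N t‖ ^ 2 * Real.exp (-c * t))
        - (harmonic N : ℝ) / c ^ 2| ≤ (1 + 4 * ∑' k : ℤ, 1 / (k : ℝ) ^ 2) * N ^ 2 := by
  set K := ∑' k : ℤ, 1 / (k : ℝ) ^ 2 with hK
  rw [← Real.norm_eq_abs, ← Complex.norm_real, Complex.ofReal_sub,
    integral_norm_dirichletPoly_sq N hc]
  set F : ℕ → ℕ → ℂ := fun n m => ((1 / √n * (1 / √m) : ℝ) : ℂ)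
        * (1 / (c + Complex.I * ((Real.log n - Real.log m : ℝ) : ℂ))) ^ 2 with hF
  have hdiag : (((harmonic N : ℝ) / c ^ 2 : ℝ) : ℂ)
      = ∑ n ∈ Finset.Icc 1 N, ∑ m ∈ Finset.Icc 1 N, if n = m then F n m else 0 := by
    have h1 : ∀ n ∈ Finset.Icc 1 N, (∑ m ∈ Finset.Icc 1 N, if n = m then F n m else 0)
        = (((n : ℝ)⁻¹ / c ^ 2 : ℝ) : ℂ) := by
      intro n hn
      rw [Finset.sum_ite_eq, if_pos hn, hF]
      simp only [sub_self, Complex.ofReal_zero, mul_zero, add_zero]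
      rw [← sq, div_pow, one_pow, Real.sq_sqrt (Nat.cast_nonneg n)]
      push_cast
      ring
    rw [Finset.sum_congr rfl h1, ← Complex.ofReal_sum, ← Finset.sum_div, harmonic_eq_sum_Icc]
    push_cast
    rfl
  rw [hdiag, ← Finset.sum_sub_distrib]
  have hbound : ∀ n ∈ Finset.Icc 1 N,
      ‖(∑ m ∈ Finset.Icc 1 N, F n m) - ∑ m ∈ Finset.Icc 1 N, if n = m then F n m else 0‖
        ≤ N + 4 * N * K := by
    intro n hn
    rw [← Finset.sum_sub_distrib]
    calc ‖∑ m ∈ Finset.Icc 1 N, (F n m - if n = m then F n m else 0)‖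
        ≤ ∑ m ∈ Finset.Icc 1 N, (1 + 4 * N * (1 / (((n : ℤ) - m : ℤ) : ℝ) ^ 2)) := by
          refine norm_sum_le_of_le _ fun m hm => ?_
          split_ifs with h
          · rw [sub_self, norm_zero]
            positivity
          · rw [sub_zero]
            exact norm_offDiagonal_le hn hm h c
      _ = N + 4 * N * ∑ m ∈ Finset.Icc 1 N, 1 / (((n : ℤ) - m : ℤ) : ℝ) ^ 2 := by
          rw [Finset.sum_add_distrib, ← Finset.mul_sum]
          simp
      _ ≤ N + 4 * N * K := by
          gcongr
          exact sum_one_div_sub_sq_le N n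
  refine (norm_sum_le_of_le _ hbound).trans_eq ?_
  simp
  ring

/-- The difference between `ζ(1/2+it)` and its partial sum of length `N`. -/
noncomputable def zetaRemainder (N : ℕ) (t : ℝ) : ℂ :=
  riemannZeta (1 / 2 + Complex.I * t) - dirichletPoly N t

theorem continuous_zetaRemainder (N : ℕ) : Continuous (zetaRemainder N) :=
  continuous_riemannZeta_half.sub (continuous_dirichletPoly N)

/-- Euler–Maclaurin at s = 1/2 + it, where |s|² = |s − 1|² = 1/4 + t², followed by |A − B|² ≤ 2(|A|²
+ |B|²). -/
theorem norm_zetaRemainder_sq_le {N : ℕ} (hN : 1 ≤ N) {t : ℝ} (ht : 0 < t) :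
    ‖zetaRemainder N t‖ ^ 2
      ≤ 2 * (N / (1 / 4 + t ^ 2) + (1 / 4 + t ^ 2) * ‖tailIntegral N t‖ ^ 2) := by
  have h := riemannZeta_eq_sum_add hN (s := 1 / 2 + Complex.I * t) (by simp) (by simpa using ht)
  have e : zetaRemainder N t = (N : ℂ) ^ (1 - (1 / 2 + Complex.I * t)) / (1 / 2 + Complex.I * t - 1)
      - (1 / 2 + Complex.I * t) * tailIntegral N t := by
    rw [zetaRemainder, h, dirichletPoly, tailIntegral]
    ring
  have hp : ‖(N : ℂ) ^ (1 - (1 / 2 + Complex.I * t) : ℂ)‖ ^ 2 = N := by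
    rw [Complex.norm_natCast_cpow_of_pos hN]
    have : (1 - (1 / 2 + Complex.I * t) : ℂ).re = 1 / 2 := by simp; norm_num
    rw [this, ← Real.sqrt_eq_rpow, Real.sq_sqrt (Nat.cast_nonneg N)]
  have h1 : ‖(N : ℂ) ^ (1 - (1 / 2 + Complex.I * t)) / (1 / 2 + Complex.I * t - 1)‖ ^ 2
      = N / (1 / 4 + t ^ 2) := by
    rw [norm_div, div_pow, hp, norm_half_add_I_mul_sub_one_sq]
  have h2 : ‖(1 / 2 + Complex.I * t) * tailIntegral N t‖ ^ 2
      = (1 / 4 + t ^ 2) * ‖tailIntegral N t‖ ^ 2 := by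
    rw [norm_mul, mul_pow, norm_half_add_I_mul_sq]
  rw [← h1, ← h2, e]
  refine (pow_le_pow_left₀ (norm_nonneg _) (norm_sub_le _ _) 2).trans ?_
  exact add_sq_le

theorem integrableOn_zetaRemainder (N : ℕ) {c : ℝ} (hc : 0 < c) :
    IntegrableOn (fun t => t * ‖zetaRemainder N t‖ ^ 2 * Real.exp (-c * t)) (Ioi 0) := by
  refine integrableOn_mul_exp_neg (C := (4 + N) ^ 2) (k := 3)
    (F := fun t => t * ‖zetaRemainder N t‖ ^ 2)
    (continuous_id.mul ((continuous_zetaRemainder N).norm.pow 2)) (fun t ht => ?_) hc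
  rw [abs_of_nonneg (mul_nonneg ht.le (sq_nonneg _))]
  have h : ‖zetaRemainder N t‖ ≤ (4 + N) * (1 + t) := by
    refine (norm_sub_le _ _).trans ?_
    have h1 := norm_riemannZeta_half_le ht
    have h2 := norm_dirichletPoly_le N t
    have h3 : (0 : ℝ) ≤ N * t := by positivity
    nlinarith
  calc t * ‖zetaRemainder N t‖ ^ 2 ≤ (1 + t) * ((4 + N) * (1 + t)) ^ 2 := by
        gcongr
        linarith
    _ = _ := by ring

theorem integrableOn_dirichletPoly (N : ℕ) {c : ℝ} (hc : 0 < c) :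
    IntegrableOn (fun t => t * ‖dirichletPoly N t‖ ^ 2 * Real.exp (-c * t)) (Ioi 0) := by
  refine integrableOn_mul_exp_neg (C := N ^ 2) (k := 1)
    (F := fun t => t * ‖dirichletPoly N t‖ ^ 2)
    (continuous_id.mul ((continuous_dirichletPoly N).norm.pow 2)) (fun t ht => ?_) hc
  rw [abs_of_nonneg (mul_nonneg ht.le (sq_nonneg _))]
  calc t * ‖dirichletPoly N t‖ ^ 2 ≤ (1 + t) * (N : ℝ) ^ 2 := by
        gcongr
        · linarith
        · exact norm_dirichletPoly_le N t
    _ = _ := by ring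

/-- Bounding the whole weight by a constant lets the unweighted mean square of the tail integral be
used. With t = xy the claim reduces to y/4 + y³ ≤ e^(2y). -/
theorem cubic_mul_exp_le {x t : ℝ} (hx : 1 ≤ x) (ht : 0 < t) :
    t * (1 / 4 + t ^ 2) * Real.exp (-(2 / x) * t) ≤ x ^ 3 := by
  have hx0 : 0 < x := by linarith
  obtain ⟨y, hy0, rfl⟩ : ∃ y, 0 < y ∧ t = x * y :=
    ⟨t / x, by positivity, by field_simp⟩
  have e : -(2 / x) * (x * y) = -(2 * y) := by field_simp
  rw [e, Real.exp_neg, ← div_eq_mul_inv, div_le_iff₀ (Real.exp_pos _)]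
  have h1 : (2 * y) ^ 3 / (Nat.factorial 3) ≤ Real.exp (2 * y) :=
    Real.pow_div_factorial_le_exp _ (by positivity) 3
  have h2 : 2 * y + 1 ≤ Real.exp (2 * y) := Real.add_one_le_exp _
  have h1' : 4 / 3 * y ^ 3 ≤ Real.exp (2 * y) := by
    refine le_trans (le_of_eq ?_) h1
    norm_num [Nat.factorial]
    ring
  -- Three quarters of the cubic bound plus one quarter of the linear one.
  have h3 : y / 4 + y ^ 3 ≤ Real.exp (2 * y) := by linarith
  have h4 : x ≤ x ^ 3 := le_self_pow₀ hx (by norm_num)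
  calc x * y * (1 / 4 + (x * y) ^ 2) = x * (y / 4) + x ^ 3 * y ^ 3 := by ring
    _ ≤ x ^ 3 * (y / 4) + x ^ 3 * y ^ 3 := by gcongr
    _ = x ^ 3 * (y / 4 + y ^ 3) := by ring
    _ ≤ _ := by gcongr

/-- The length N = ⌈x⌉ balances the two contributions N · x and x³/N, both of order x². -/
theorem integral_zetaRemainder_le {x : ℝ} (hx : 1 ≤ x) :
    ∫ t in Ioi (0 : ℝ), t * ‖zetaRemainder ⌈x⌉₊ t‖ ^ 2 * Real.exp (-(2 / x) * t)
      ≤ (2 + 4 * Real.pi) * x ^ 2 := by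
  have hx0 : 0 < x := by linarith
  set N := ⌈x⌉₊ with hNdef
  have hxN : x ≤ N := Nat.le_ceil x
  have hN2 : (N : ℝ) ≤ 2 * x := by linarith [(Nat.ceil_lt_add_one hx0.le).le]
  have hN : 1 ≤ N := by exact_mod_cast hx.trans hxN
  have hc : 0 < 2 / x := by positivity
  have hexp : IntegrableOn (fun t : ℝ => Real.exp (-(2 / x) * t)) (Ioi 0) :=
    integrableOn_exp_mul_Ioi (neg_neg_of_pos hc) 0
  have hJ := integral_norm_sq_tailIntegral_le hN
  have hmono : ∫ t in Ioi (0 : ℝ), t * ‖zetaRemainder N t‖ ^ 2 * Real.exp (-(2 / x) * t)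
      ≤ ∫ t in Ioi (0 : ℝ),
        (2 * N * Real.exp (-(2 / x) * t) + 2 * x ^ 3 * ‖tailIntegral N t‖ ^ 2) := by
    refine setIntegral_mono_on (integrableOn_zetaRemainder N hc)
      ((hexp.const_mul _).add (hJ.1.integrableOn.const_mul _)) measurableSet_Ioi fun t ht => ?_
    have ht0 : (0 : ℝ) < t := ht
    have h1 := norm_zetaRemainder_sq_le hN ht0
    have h2 := cubic_mul_exp_le hx ht0
    have h3 : t * (N / (1 / 4 + t ^ 2)) ≤ N := by
      rw [mul_div_assoc', div_le_iff₀ (by positivity)]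
      nlinarith [sq_nonneg (t - 1 / 2), (Nat.cast_nonneg N : (0 : ℝ) ≤ N)]
    calc t * ‖zetaRemainder N t‖ ^ 2 * Real.exp (-(2 / x) * t)
        ≤ t * (2 * (N / (1 / 4 + t ^ 2) + (1 / 4 + t ^ 2) * ‖tailIntegral N t‖ ^ 2))
          * Real.exp (-(2 / x) * t) := by gcongr
      _ = 2 * (t * (N / (1 / 4 + t ^ 2))) * Real.exp (-(2 / x) * t)
          + 2 * (t * (1 / 4 + t ^ 2) * Real.exp (-(2 / x) * t)) * ‖tailIntegral N t‖ ^ 2 := by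
          ring
      _ ≤ _ := by gcongr
  refine hmono.trans ?_
  rw [integral_add (hexp.const_mul _) (hJ.1.integrableOn.const_mul _), integral_const_mul,
    integral_const_mul, integral_exp_mul_Ioi (neg_neg_of_pos hc)]
  have h4 : ∫ t in Ioi (0 : ℝ), ‖tailIntegral N t‖ ^ 2 ≤ 2 * Real.pi / N :=
    (setIntegral_le_integral hJ.1 (.of_forall fun _ => by positivity)).trans hJ.2
  have h5 : 2 * Real.pi / N ≤ 2 * Real.pi / x := by gcongr
  have e1 : -Real.exp (-(2 / x) * 0) / -(2 / x) = x / 2 := by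
    rw [mul_zero, Real.exp_zero]; field_simp
  rw [e1]
  calc 2 * N * (x / 2) + 2 * x ^ 3 * ∫ t in Ioi (0 : ℝ), ‖tailIntegral N t‖ ^ 2
      ≤ 2 * (2 * x) * (x / 2) + 2 * x ^ 3 * (2 * Real.pi / x) := by
        gcongr
        exact h4.trans h5
    _ = _ := by field_simp; ring

end JacobLadder

/-! ### The asymptotics of the first moment of Z² -/

namespace JacobLadder

/-- The first moment `∫_0^∞ t Z²(t) e^(-2t/x) dt`. -/
noncomputable def moment (x : ℝ) : ℝ :=
  ∫ t in Ioi (0 : ℝ), t * hardyZ t ^ 2 * Real.exp (-(2 / x) * t)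

/-- The first moment with the partial sum of length `⌈x⌉` in place of `ζ`. -/
noncomputable def polyMoment (x : ℝ) : ℝ :=
  ∫ t in Ioi (0 : ℝ), t * ‖dirichletPoly ⌈x⌉₊ t‖ ^ 2 * Real.exp (-(2 / x) * t)

theorem exists_abs_polyMoment_sub_le :
    ∃ C, ∀ x, 1 ≤ x → |polyMoment x - x ^ 2 / 4 * Real.log x| ≤ C * x ^ 2 := by
  set K := ∑' k : ℤ, 1 / (k : ℝ) ^ 2 with hK
  have hK0 : 0 ≤ K := tsum_nonneg fun k => by positivity
  -- The 4 is the square of 2 in ⌈x⌉ ≤ 2x; 1 + ln 2 bounds the excess of the harmonic sum over ln x.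
  refine ⟨(1 + 4 * K) * 4 + (1 + Real.log 2), fun x hx => ?_⟩
  have hx0 : 0 < x := by linarith
  have hN2 : (⌈x⌉₊ : ℝ) ≤ 2 * x := by linarith [(Nat.ceil_lt_add_one hx0.le).le]
  have hxN : x ≤ ⌈x⌉₊ := Nat.le_ceil x
  have h1 := abs_integral_dirichletPoly_sub_le ⌈x⌉₊ (c := 2 / x) (by positivity)
  have h2 : Real.log x ≤ harmonic ⌈x⌉₊ := by
    refine le_trans (Real.log_le_log hx0 ?_) (log_add_one_le_harmonic _)
    push_cast
    linarith
  have h3 : (harmonic ⌈x⌉₊ : ℝ) ≤ 1 + (Real.log 2 + Real.log x) := by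
    refine (harmonic_le_one_add_log _).trans ?_
    rw [← Real.log_mul two_ne_zero hx0.ne']
    gcongr
  have h4 : (harmonic ⌈x⌉₊ : ℝ) / (2 / x) ^ 2 - x ^ 2 / 4 * Real.log x
      = x ^ 2 / 4 * (harmonic ⌈x⌉₊ - Real.log x) := by
    field_simp
    ring
  have hl2 : 0 < Real.log 2 := Real.log_pos one_lt_two
  have h5 : |x ^ 2 / 4 * (harmonic ⌈x⌉₊ - Real.log x)| ≤ (1 + Real.log 2) * x ^ 2 := by
    rw [abs_of_nonneg (mul_nonneg (by positivity) (by linarith))]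
    calc x ^ 2 / 4 * (harmonic ⌈x⌉₊ - Real.log x) ≤ x ^ 2 * (1 + Real.log 2) := by
          gcongr
          · nlinarith [sq_nonneg x]
          · linarith
      _ = _ := by ring
  calc |polyMoment x - x ^ 2 / 4 * Real.log x|
      = |(polyMoment x - (harmonic ⌈x⌉₊ : ℝ) / (2 / x) ^ 2)
          + ((harmonic ⌈x⌉₊ : ℝ) / (2 / x) ^ 2 - x ^ 2 / 4 * Real.log x)| := by ring_nf
    _ ≤ (1 + 4 * K) * (⌈x⌉₊ : ℝ) ^ 2 + (1 + Real.log 2) * x ^ 2 := by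
        refine (abs_add_le _ _).trans (add_le_add h1 ?_)
        rw [h4]
        exact h5
    _ ≤ (1 + 4 * K) * (2 * x) ^ 2 + (1 + Real.log 2) * x ^ 2 := by gcongr
    _ = _ := by ring

/-- The cross term is split by AM–GM with a free η. As E has moment O(x²) against x² ln x for D,
letting η be small after x is large makes E negligible. -/
theorem abs_norm_add_sq_sub_le (D E : ℂ) {η : ℝ} (hη : 0 < η) :
    |‖D + E‖ ^ 2 - ‖D‖ ^ 2| ≤ η * ‖D‖ ^ 2 + (1 + 1 / η) * ‖E‖ ^ 2 := by
  have h0 : |‖D + E‖ - ‖D‖| ≤ ‖E‖ := by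
    simpa using abs_norm_sub_norm_le (D + E) D
  have h1 : ‖D + E‖ + ‖D‖ ≤ 2 * ‖D‖ + ‖E‖ := by linarith [norm_add_le D E]
  have h2 : 2 * ‖D‖ * ‖E‖ ≤ η * ‖D‖ ^ 2 + 1 / η * ‖E‖ ^ 2 := by
    have h := sq_nonneg (η * ‖D‖ - ‖E‖)
    have : η * ‖D‖ ^ 2 + 1 / η * ‖E‖ ^ 2 - 2 * ‖D‖ * ‖E‖ = (η * ‖D‖ - ‖E‖) ^ 2 / η := by
      field_simp
      ring
    have : 0 ≤ (η * ‖D‖ - ‖E‖) ^ 2 / η := by positivity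
    linarith
  rw [sq_sub_sq, abs_mul, abs_of_nonneg (by positivity : 0 ≤ ‖D + E‖ + ‖D‖)]
  calc (‖D + E‖ + ‖D‖) * |‖D + E‖ - ‖D‖| ≤ (2 * ‖D‖ + ‖E‖) * ‖E‖ := by gcongr
    _ = 2 * ‖D‖ * ‖E‖ + ‖E‖ ^ 2 := by ring
    _ ≤ _ := by linarith

theorem abs_moment_sub_polyMoment_le {x η : ℝ} (hx : 1 ≤ x) (hη : 0 < η) :
    |moment x - polyMoment x|
      ≤ η * polyMoment x + (1 + 1 / η) * ((2 + 4 * Real.pi) * x ^ 2) := by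
  have hc : 0 < 2 / x := by positivity
  have hM := integrableOn_moment hc
  have hD := integrableOn_dirichletPoly ⌈x⌉₊ hc
  have hE := integrableOn_zetaRemainder ⌈x⌉₊ hc
  rw [moment, polyMoment, ← integral_sub hM hD, ← Real.norm_eq_abs]
  calc ‖∫ t in Ioi (0 : ℝ), (t * hardyZ t ^ 2 * Real.exp (-(2 / x) * t)
        - t * ‖dirichletPoly ⌈x⌉₊ t‖ ^ 2 * Real.exp (-(2 / x) * t))‖
      ≤ ∫ t in Ioi (0 : ℝ), (η * (t * ‖dirichletPoly ⌈x⌉₊ t‖ ^ 2 * Real.exp (-(2 / x) * t))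
        + (1 + 1 / η) * (t * ‖zetaRemainder ⌈x⌉₊ t‖ ^ 2 * Real.exp (-(2 / x) * t))) := by
        refine norm_integral_le_of_norm_le ((hD.const_mul _).add (hE.const_mul _)) ?_
        refine (ae_restrict_iff' measurableSet_Ioi).mpr (.of_forall fun t ht => ?_)
        have ht0 : (0 : ℝ) < t := ht
        have h := abs_norm_add_sq_sub_le (dirichletPoly ⌈x⌉₊ t) (zetaRemainder ⌈x⌉₊ t) hη
        rw [show dirichletPoly ⌈x⌉₊ t + zetaRemainder ⌈x⌉₊ t
          = riemannZeta (1 / 2 + Complex.I * t) by rw [zetaRemainder]; ring, ← hardyZ_sq] at h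
        rw [Real.norm_eq_abs, ← sub_mul, ← mul_sub, abs_mul, abs_mul, abs_of_pos ht0,
          Real.abs_exp]
        calc t * |hardyZ t ^ 2 - ‖dirichletPoly ⌈x⌉₊ t‖ ^ 2| * Real.exp (-(2 / x) * t)
            ≤ t * (η * ‖dirichletPoly ⌈x⌉₊ t‖ ^ 2 + (1 + 1 / η) * ‖zetaRemainder ⌈x⌉₊ t‖ ^ 2)
              * Real.exp (-(2 / x) * t) := by gcongr
          _ = _ := by ring
    _ ≤ _ := by
        rw [integral_add (hD.const_mul _) (hE.const_mul _), integral_const_mul,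
          integral_const_mul]
        gcongr
        exact integral_zetaRemainder_le hx

theorem tendsto_polyMoment :
    Tendsto (fun x => polyMoment x / (x ^ 2 * Real.log x)) atTop (nhds (1 / 4)) := by
  obtain ⟨C, hC⟩ := exists_abs_polyMoment_sub_le
  rw [tendsto_iff_norm_sub_tendsto_zero]
  have h0 : Tendsto (fun x => C / Real.log x) atTop (nhds 0) :=
    Real.tendsto_log_atTop.const_div_atTop C
  refine squeeze_zero' (.of_forall fun _ => norm_nonneg _) ?_ h0
  filter_upwards [eventually_gt_atTop 1] with x hx
  have hl : 0 < Real.log x := Real.log_pos hx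
  have e : polyMoment x / (x ^ 2 * Real.log x) - 1 / 4
      = (polyMoment x - x ^ 2 / 4 * Real.log x) / (x ^ 2 * Real.log x) := by
    have : x ≠ 0 := by positivity
    field_simp
  rw [e, norm_div, Real.norm_eq_abs, Real.norm_of_nonneg (by positivity),
    div_le_div_iff₀ (by positivity) hl]
  calc _ ≤ C * x ^ 2 * Real.log x := by gcongr; exact hC x hx.le
    _ = _ := by ring

/-- The Hardy–Littlewood mean square asymptotics, in Abelian form. -/
theorem tendsto_moment :
    Tendsto (fun x => moment x / (x ^ 2 * Real.log x)) atTop (nhds (1 / 4)) := by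
  suffices h : Tendsto (fun x => moment x / (x ^ 2 * Real.log x)
      - polyMoment x / (x ^ 2 * Real.log x)) atTop (nhds 0) by
    simpa using h.add tendsto_polyMoment
  rw [Metric.tendsto_atTop']
  intro η hη
  -- For fixed η the error bound tends to η/4, which is below η.
  have h1 : Tendsto (fun x => η * (polyMoment x / (x ^ 2 * Real.log x))
      + (1 + 1 / η) * (2 + 4 * Real.pi) / Real.log x) atTop (nhds (η * (1 / 4) + 0)) :=
    (tendsto_polyMoment.const_mul η).add (Real.tendsto_log_atTop.const_div_atTop _)
  have h2 := h1.eventually_lt_const (show η * (1 / 4) + 0 < η by linarith)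
  obtain ⟨X, hX⟩ := eventually_atTop.mp (h2.and (eventually_gt_atTop 1))
  refine ⟨X, fun x hx => ?_⟩
  obtain ⟨h3, h4⟩ := hX x hx.le
  have hl : 0 < Real.log x := Real.log_pos h4
  have hx0 : x ≠ 0 := by positivity
  rw [dist_zero_right, ← sub_div, norm_div, Real.norm_eq_abs,
    Real.norm_of_nonneg (by positivity)]
  refine lt_of_le_of_lt ?_ h3
  rw [div_le_iff₀ (by positivity)]
  refine (abs_moment_sub_polyMoment_le h4.le hη).trans_eq ?_
  field_simp

end JacobLadder

/-! ### The two sides of the defining equation: monotonicity, divergence, derivatives -/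

namespace JacobLadder

theorem exists_hardyZ_sq_pos {a b : ℝ} (hab : a < b) : ∃ c ∈ Ioo a b, 0 < hardyZ c ^ 2 := by
  obtain ⟨c, hc, hcab⟩ := (countable_hardyZ_zeros.dense_compl ℝ).exists_mem_open isOpen_Ioo
    (nonempty_Ioo.mpr hab)
  exact ⟨c, hcab, lt_of_le_of_ne (sq_nonneg _) fun h => hc h.symm⟩

theorem integral_mul_hardyZ_sq_pos {g : ℝ → ℝ} (hg : Continuous g) {a b : ℝ} (hab : a < b)
    (hpos : ∀ t ∈ Ioo a b, 0 < g t) : 0 < ∫ t in a..b, hardyZ t ^ 2 * g t := by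
  obtain ⟨c, hc, hc0⟩ := exists_hardyZ_sq_pos hab
  have hcl : ∀ t ∈ Icc a b, 0 ≤ g t := by
    have h : closure (Ioo a b) ⊆ {t | 0 ≤ g t} :=
      closure_minimal (fun t ht => (hpos t ht).le) (isClosed_le continuous_const hg)
    rwa [closure_Ioo hab.ne] at h
  have := intervalIntegral.integral_lt_integral_of_continuousOn_of_le_of_exists_lt
    (f := fun _ => (0 : ℝ)) (g := fun t => hardyZ t ^ 2 * g t) hab continuousOn_const
    (continuous_hardyZ_sq.mul hg).continuousOn
    (fun t ht => mul_nonneg (sq_nonneg _) (hcl t (Ioc_subset_Icc_self ht)))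
    ⟨c, Ioo_subset_Icc_self hc, mul_pos hc0 (hpos c hc)⟩
  simpa using this

theorem hasDerivAt_hardyLittlewood (T : ℝ) :
    HasDerivAt hardyLittlewood (hardyZ T ^ 2) T :=
  (continuous_hardyZ_sq.integral_hasStrictDerivAt 0 T).hasDerivAt

theorem continuous_hardyLittlewood : Continuous hardyLittlewood :=
  continuous_iff_continuousAt.mpr fun T => (hasDerivAt_hardyLittlewood T).continuousAt

theorem strictMono_hardyLittlewood : StrictMono hardyLittlewood := by
  intro a b hab
  have h := integral_mul_hardyZ_sq_pos (g := fun _ => 1) continuous_const hab fun _ _ => one_pos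
  simp only [mul_one] at h
  rw [← intervalIntegral.integral_interval_sub_left
    (continuous_hardyZ_sq.intervalIntegrable 0 b) (continuous_hardyZ_sq.intervalIntegrable 0 a)] at h
  exact sub_pos.mp h

theorem hardyLittlewood_zero : hardyLittlewood 0 = 0 := intervalIntegral.integral_same

/-- Since t e^(−2t/x) ≤ x. A bounded ∫ Z² would make the moment O(x), against its true order x² ln
x. -/
theorem moment_le_of_hardyLittlewood_le {M : ℝ} (hM : ∀ T, hardyLittlewood T ≤ M) {x : ℝ}
    (hx : 0 < x) : moment x ≤ x * M := by
  refine le_of_tendsto (intervalIntegral_tendsto_integral_Ioi 0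
    (integrableOn_moment (c := 2 / x) (by positivity)) tendsto_id) ?_
  filter_upwards [eventually_ge_atTop 0] with R hR
  have hb : ∀ t ∈ Icc 0 R, t * hardyZ t ^ 2 * Real.exp (-(2 / x) * t) ≤ x * hardyZ t ^ 2 := by
    intro t ht
    have h1 : 2 / x * t ≤ Real.exp (2 / x * t) := by linarith [Real.add_one_le_exp (2 / x * t)]
    have h2 : t * Real.exp (-(2 / x) * t) ≤ x := by
      rw [neg_mul, Real.exp_neg, ← div_eq_mul_inv, div_le_iff₀ (Real.exp_pos _)]
      calc t = x * (1 / 2 * (2 / x * t)) := by field_simp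
        _ ≤ x * Real.exp (2 / x * t) := by
          gcongr
          linarith [Real.exp_pos (2 / x * t)]
    calc t * hardyZ t ^ 2 * Real.exp (-(2 / x) * t)
        = t * Real.exp (-(2 / x) * t) * hardyZ t ^ 2 := by ring
      _ ≤ _ := by gcongr
  refine (intervalIntegral.integral_mono_on (a := 0) (b := R)
    (g := fun t => x * hardyZ t ^ 2) hR ?_ ?_ hb).trans ?_
  · exact ((continuous_id.mul continuous_hardyZ_sq).mul (by fun_prop)).intervalIntegrable _ _
  · exact (continuous_const.mul continuous_hardyZ_sq).intervalIntegrable _ _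
  · rw [intervalIntegral.integral_const_mul]
    exact mul_le_mul_of_nonneg_left (hM R) hx.le

theorem tendsto_hardyLittlewood : Tendsto hardyLittlewood atTop atTop := by
  rcases tendsto_atTop_of_monotone strictMono_hardyLittlewood.monotone with h | ⟨M, hM⟩
  · exact h
  exfalso
  have hle : ∀ T, hardyLittlewood T ≤ M := fun T =>
    strictMono_hardyLittlewood.monotone.ge_of_tendsto hM T
  have h0 : Tendsto (fun x => |M| / (x * Real.log x)) atTop (nhds 0) :=
    (tendsto_id.atTop_mul_atTop₀ Real.tendsto_log_atTop).const_div_atTop _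
  have h1 := le_of_tendsto_of_tendsto tendsto_moment h0 (by
    filter_upwards [eventually_gt_atTop 1] with x hx
    have hl := Real.log_pos hx
    have hx0 : 0 < x := by linarith
    rw [div_le_div_iff₀ (by positivity) (by positivity)]
    calc moment x * (x * Real.log x) ≤ (x * |M|) * (x * Real.log x) := by
          gcongr
          exact (moment_le_of_hardyLittlewood_le hle hx0).trans (by gcongr; exact le_abs_self M)
      _ = _ := by ring)
  norm_num at h1

/-- The incomplete Laplace transform `∫_0^y Z²(t) e^(-dt) dt`. -/
noncomputable def laplace (y d : ℝ) : ℝ := ∫ t in (0 : ℝ)..y, hardyZ t ^ 2 * Real.exp (-d * t)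

theorem hasDerivAt_laplace_left (y d : ℝ) :
    HasDerivAt (fun y => laplace y d) (hardyZ y ^ 2 * Real.exp (-d * y)) y :=
  ((continuous_hardyZ_sq.mul (by fun_prop)).integral_hasStrictDerivAt 0 y).hasDerivAt

theorem hasDerivAt_laplace_right (y d : ℝ) :
    HasDerivAt (laplace y) (-∫ t in (0 : ℝ)..y, t * hardyZ t ^ 2 * Real.exp (-d * t)) d := by
  rw [← intervalIntegral.integral_neg]
  have hZ := continuous_hardyZ_sq
  refine (intervalIntegral.hasDerivAt_integral_of_dominated_loc_of_deriv_le
    (F := fun d t => hardyZ t ^ 2 * Real.exp (-d * t))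
    (F' := fun d t => -(t * hardyZ t ^ 2 * Real.exp (-d * t)))
    (bound := fun t => |t| * hardyZ t ^ 2 * Real.exp ((|d| + 1) * |t|))
    (Metric.ball_mem_nhds d one_pos) ?_ ?_ ?_ ?_ ?_ ?_).2
  · exact .of_forall fun d => (hZ.mul (by fun_prop)).aestronglyMeasurable
  · exact (hZ.mul (by fun_prop)).intervalIntegrable _ _
  · exact ((continuous_id.mul hZ).mul (by fun_prop)).neg.aestronglyMeasurable
  · refine .of_forall fun t _ e he => ?_
    rw [norm_neg, norm_mul, norm_mul, Real.norm_eq_abs, Real.norm_of_nonneg (sq_nonneg _),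
      Real.norm_of_nonneg (Real.exp_pos _).le]
    refine mul_le_mul_of_nonneg_left (Real.exp_le_exp.mpr ?_) (by positivity)
    have h1 : |e| ≤ |d| + 1 := by
      have := mem_ball_iff_norm.mp he
      rw [Real.norm_eq_abs] at this
      linarith [abs_sub_abs_le_abs_sub e d]
    calc -e * t ≤ |-e * t| := le_abs_self _
      _ = |e| * |t| := by rw [abs_mul, abs_neg]
      _ ≤ _ := by gcongr
  · exact ((continuous_abs.mul hZ).mul (by fun_prop)).intervalIntegrable _ _
  · refine .of_forall fun t _ e _ => ?_
    have h := (((hasDerivAt_id e).neg.mul_const t).exp).const_mul (hardyZ t ^ 2)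
    refine h.congr_deriv ?_
    simp only [Pi.neg_apply, id]
    ring

/-- The derivative of `smoothed μ`. -/
noncomputable def smoothedDeriv (μ : ℝ → ℝ) (x : ℝ) : ℝ :=
  hardyZ (μ x) ^ 2 * Real.exp (-(2 / x) * μ x) * deriv μ x
    + 2 / x ^ 2 * ∫ t in (0 : ℝ)..μ x, t * hardyZ t ^ 2 * Real.exp (-(2 / x) * t)

/-- The chain rule for `laplace` at (μ x, 2/x), which is jointly differentiable because both partial
derivatives are jointly continuous. -/
theorem hasDerivAt_smoothed {μ : ℝ → ℝ} {x : ℝ} (hx : x ≠ 0) (hμ : DifferentiableAt ℝ μ x) :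
    HasDerivAt (smoothed μ) (smoothedDeriv μ x) x := by
  have hZ := continuous_hardyZ_sq
  have hcont1 : Continuous fun v : ℝ × ℝ => hardyZ v.1 ^ 2 * Real.exp (-v.2 * v.1) :=
    (hZ.comp continuous_fst).mul (by fun_prop)
  have hcont2 : Continuous fun v : ℝ × ℝ =>
      -∫ t in (0 : ℝ)..v.1, t * hardyZ t ^ 2 * Real.exp (-v.2 * t) := by
    refine (intervalIntegral.continuous_parametric_intervalIntegral_of_continuous
      (f := fun (v : ℝ × ℝ) t => t * hardyZ t ^ 2 * Real.exp (-v.2 * t)) ?_ continuous_fst).neg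
    exact (continuous_snd.mul (hZ.comp continuous_snd)).mul (by fun_prop)
  have h := hasStrictFDerivAt_uncurry_coprod (𝕜 := ℝ) (u := (μ x, 2 / x)) (f := laplace)
    (f₁ := fun y d => ContinuousLinearMap.toSpanSingleton ℝ (hardyZ y ^ 2 * Real.exp (-d * y)))
    (f₂ := fun y d => ContinuousLinearMap.toSpanSingleton ℝ
      (-∫ t in (0 : ℝ)..y, t * hardyZ t ^ 2 * Real.exp (-d * t)))
    (.of_forall fun v => (hasDerivAt_laplace_left v.1 v.2).hasFDerivAt)
    (.of_forall fun v => (hasDerivAt_laplace_right v.1 v.2).hasFDerivAt)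
    ((ContinuousLinearMap.toSpanSingletonCLE (𝕜 := ℝ) (E := ℝ)).continuous.comp
      hcont1).continuousAt
    ((ContinuousLinearMap.toSpanSingletonCLE (𝕜 := ℝ) (E := ℝ)).continuous.comp
      hcont2).continuousAt
  have hd : HasDerivAt (fun x : ℝ => 2 / x) (-(2 / x ^ 2)) x := by
    simpa [div_eq_mul_inv] using (hasDerivAt_inv hx).const_mul 2
  have hc := h.hasFDerivAt.comp_hasDerivAt x (hμ.hasDerivAt.prodMk hd)
  refine hc.congr_deriv ?_
  simp [smoothedDeriv, Function.HasUncurry.uncurry]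
  ring

theorem smoothedDeriv_pos {μ : ℝ → ℝ} {x : ℝ} (hx : x ≠ 0) (hd : 0 ≤ deriv μ x) (hμ : 0 < μ x) :
    0 < smoothedDeriv μ x := by
  have h := integral_mul_hardyZ_sq_pos (g := fun t => t * Real.exp (-(2 / x) * t))
    (by fun_prop) hμ fun t ht => mul_pos ht.1 (Real.exp_pos _)
  have e : ∫ t in (0 : ℝ)..μ x, t * hardyZ t ^ 2 * Real.exp (-(2 / x) * t)
      = ∫ t in (0 : ℝ)..μ x, hardyZ t ^ 2 * (t * Real.exp (-(2 / x) * t)) := by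
    congr 1
    ext t
    ring
  rw [smoothedDeriv, e]
  refine add_pos_of_nonneg_of_pos ?_ (by positivity)
  positivity

theorem smoothed_nonpos {μ : ℝ → ℝ} {x : ℝ} (hμ : μ x ≤ 0) : smoothed μ x ≤ 0 := by
  rw [smoothed, intervalIntegral.integral_symm, neg_nonpos]
  exact intervalIntegral.integral_nonneg hμ fun t _ => by positivity

/-- Passing from x to z raises the exponential weight strictly on (0, μ x) and does not shorten the
interval. -/
theorem smoothed_lt_smoothed {μ : ℝ → ℝ} {x z : ℝ} (hx : 0 < x) (hxz : x < z) (hμ : 0 < μ x)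
    (hle : μ x ≤ μ z) : smoothed μ x < smoothed μ z := by
  have hZ := continuous_hardyZ_sq
  have hi : ∀ d a b : ℝ, IntervalIntegrable (fun t => hardyZ t ^ 2 * Real.exp (-d * t)) volume a b :=
    fun d a b => (hZ.mul (by fun_prop)).intervalIntegrable _ _
  have h1 := integral_mul_hardyZ_sq_pos
    (g := fun t => Real.exp (-(2 / z) * t) - Real.exp (-(2 / x) * t)) (by fun_prop) hμ
    fun t ht => sub_pos.mpr (Real.exp_lt_exp.mpr (by
      have : 2 / z < 2 / x := by gcongr
      nlinarith [ht.1]))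
  simp only [mul_sub] at h1
  rw [intervalIntegral.integral_sub (hi _ _ _) (hi _ _ _)] at h1
  have h2 : 0 ≤ ∫ t in μ x..μ z, hardyZ t ^ 2 * Real.exp (-(2 / z) * t) :=
    intervalIntegral.integral_nonneg hle fun t _ => by positivity
  rw [smoothed, smoothed, ← intervalIntegral.integral_add_adjacent_intervals (hi _ 0 (μ x))
    (hi _ (μ x) (μ z))]
  linarith

/-- The weight e^(−2t/x) is at least e^(−2) on [0, x]. -/
theorem hardyLittlewood_le_smoothed {μ : ℝ → ℝ} {x : ℝ} (hx : 0 < x) (hμ : x ≤ μ x) :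
    Real.exp (-2) * hardyLittlewood x ≤ smoothed μ x := by
  have hZ := continuous_hardyZ_sq
  have hi : ∀ d a b : ℝ, IntervalIntegrable (fun t => hardyZ t ^ 2 * Real.exp (-d * t)) volume a b :=
    fun d a b => (hZ.mul (by fun_prop)).intervalIntegrable _ _
  have h2 : 0 ≤ ∫ t in x..μ x, hardyZ t ^ 2 * Real.exp (-(2 / x) * t) :=
    intervalIntegral.integral_nonneg hμ fun t _ => by positivity
  rw [smoothed, ← intervalIntegral.integral_add_adjacent_intervals (hi _ 0 x) (hi _ x (μ x)),
    hardyLittlewood, ← intervalIntegral.integral_const_mul]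
  refine le_add_of_le_of_nonneg ?_ h2
  refine intervalIntegral.integral_mono_on hx.le
    ((continuous_const.mul hZ).intervalIntegrable _ _) (hi _ _ _) fun t ht => ?_
  rw [mul_comm]
  gcongr
  have : 2 / x * t ≤ 2 / x * x := mul_le_mul_of_nonneg_left ht.2 (by positivity)
  rw [div_mul_cancel₀ _ hx.ne'] at this
  linarith

theorem smoothed_le_hardyLittlewood {μ : ℝ → ℝ} {x : ℝ} (hx : 0 < x) (hμ : 0 ≤ μ x) :
    smoothed μ x ≤ hardyLittlewood (μ x) := by
  have hZ := continuous_hardyZ_sq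
  refine intervalIntegral.integral_mono_on hμ ((hZ.mul (by fun_prop)).intervalIntegrable _ _)
    (hZ.intervalIntegrable _ _) fun t ht => ?_
  refine mul_le_of_le_one_right (sq_nonneg _) (Real.exp_le_one_iff.mpr ?_)
  rw [neg_mul, neg_nonpos]
  exact mul_nonneg (by positivity) ht.1

end JacobLadder

/-! ### Construction of the ladder from a generator -/

namespace JacobLadder

/-- A threshold past which a generator satisfies `x ≤ μ x`. -/
noncomputable def threshold (y₀ : ℝ) : ℝ := max (y₀ + 1) (Real.exp 1)

theorem lt_threshold (y₀ : ℝ) : y₀ < threshold y₀ :=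
  (lt_add_one y₀).trans_le (le_max_left _ _)

theorem threshold_pos (y₀ : ℝ) : 0 < threshold y₀ :=
  (Real.exp_pos 1).trans_le (le_max_right _ _)

variable {μ : ℝ → ℝ} {y₀ : ℝ}

theorem IsGenerator.differentiableAt (hμ : IsGenerator μ y₀) {x : ℝ} (hx : y₀ < x) :
    DifferentiableAt ℝ μ x :=
  (hμ.smooth.contDiffAt (Ici_mem_nhds hx)).differentiableAt (by simp)

theorem IsGenerator.deriv_nonneg (hμ : IsGenerator μ y₀) {x : ℝ} (hx : y₀ < x) :
    0 ≤ deriv μ x := by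
  rw [← derivWithin_of_mem_nhds (Ici_mem_nhds hx)]
  exact hμ.mono.derivWithin_nonneg

theorem IsGenerator.hasDerivAt_smoothed (hμ : IsGenerator μ y₀) {x : ℝ} (hx : y₀ < x) :
    HasDerivAt (smoothed μ) (smoothedDeriv μ x) x :=
  JacobLadder.hasDerivAt_smoothed (hμ.pos.trans hx).ne' (hμ.differentiableAt hx)

theorem IsGenerator.le_of_threshold_le (hμ : IsGenerator μ y₀) {x : ℝ} (hx : threshold y₀ ≤ x) :
    x ≤ μ x := by
  have hx0 : 0 < x := (threshold_pos y₀).trans_le hx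
  have h1 : 1 ≤ Real.log x := by
    rw [Real.le_log_iff_exp_le hx0]
    exact (le_max_right _ _).trans hx
  have h2 := hμ.growth x ((lt_threshold y₀).le.trans hx)
  nlinarith

/-- If y₀ < 1, then μ may be negative near y₀ and monotonicity may fail there. A positive value of
`smoothed μ` excludes this, and only positive values occur in the equation for T > 0. -/
theorem IsGenerator.smoothed_lt (hμ : IsGenerator μ y₀) {x z : ℝ} (hx : y₀ ≤ x) (hxz : x < z)
    (h : 0 < smoothed μ x) : smoothed μ x < smoothed μ z := by
  have hpos : 0 < μ x := by
    by_contra hn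
    exact absurd (smoothed_nonpos (not_lt.mp hn)) (not_le.mpr h)
  exact smoothed_lt_smoothed (hμ.pos.trans_le hx) hxz hpos (hμ.mono hx (hx.trans hxz.le) hxz.le)

theorem IsGenerator.eq_of_smoothed_eq (hμ : IsGenerator μ y₀) {x z : ℝ} (hx : y₀ ≤ x)
    (hz : y₀ ≤ z) (h : 0 < smoothed μ x) (hxz : smoothed μ x = smoothed μ z) : x = z := by
  rcases lt_trichotomy x z with h1 | h1 | h1
  · exact absurd hxz (hμ.smoothed_lt hx h1 h).ne
  · exact h1
  · exact absurd hxz.symm (hμ.smoothed_lt hz h1 (hxz ▸ h)).ne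

theorem IsGenerator.smoothed_pos (hμ : IsGenerator μ y₀) {x : ℝ} (hx : threshold y₀ ≤ x) :
    0 < smoothed μ x := by
  have hx0 : 0 < x := (threshold_pos y₀).trans_le hx
  refine lt_of_lt_of_le ?_ (hardyLittlewood_le_smoothed hx0 (hμ.le_of_threshold_le hx))
  have := strictMono_hardyLittlewood hx0
  rw [hardyLittlewood_zero] at this
  positivity

theorem IsGenerator.strictMonoOn_smoothed (hμ : IsGenerator μ y₀) :
    StrictMonoOn (smoothed μ) (Ici (threshold y₀)) := fun _ hx _ _ hxz =>
  hμ.smoothed_lt ((lt_threshold y₀).le.trans hx) hxz (hμ.smoothed_pos hx)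

theorem IsGenerator.tendsto_smoothed (hμ : IsGenerator μ y₀) :
    Tendsto (smoothed μ) atTop atTop := by
  refine tendsto_atTop_mono' _ ?_
    (tendsto_hardyLittlewood.const_mul_atTop (Real.exp_pos (-2)))
  filter_upwards [eventually_ge_atTop (threshold y₀)] with x hx
  exact hardyLittlewood_le_smoothed ((threshold_pos y₀).trans_le hx) (hμ.le_of_threshold_le hx)

theorem IsGenerator.exists_smoothed_eq (hμ : IsGenerator μ y₀) {v : ℝ}
    (hv : smoothed μ (threshold y₀) < v) : ∃ x, threshold y₀ < x ∧ smoothed μ x = v := by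
  obtain ⟨X, hX1, hX2⟩ := ((hμ.tendsto_smoothed.eventually_gt_atTop v).and
    (eventually_gt_atTop (threshold y₀))).exists
  have hc : ContinuousOn (smoothed μ) (Icc (threshold y₀) X) := fun x hx =>
    (hμ.hasDerivAt_smoothed ((lt_threshold y₀).trans_le hx.1)).continuousAt.continuousWithinAt
  obtain ⟨x, hx, hxv⟩ := intermediate_value_Ioo hX2.le hc ⟨hv, hX1⟩
  exact ⟨x, hx.1, hxv⟩

/-- The inverse function of `smoothed μ`. -/
noncomputable def smoothedInv (μ : ℝ → ℝ) (y₀ v : ℝ) : ℝ :=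
  Function.invFunOn (smoothed μ) (Ici y₀) v

/-- The preimage is chosen from all of [y₀, ∞), so uniqueness is needed there and not only beyond
the threshold. -/
theorem IsGenerator.smoothedInv_smoothed (hμ : IsGenerator μ y₀) {x : ℝ}
    (hx : threshold y₀ ≤ x) : smoothedInv μ y₀ (smoothed μ x) = x := by
  have hx0 : x ∈ Ici y₀ := (lt_threshold y₀).le.trans hx
  have he : ∃ z ∈ Ici y₀, smoothed μ z = smoothed μ x := ⟨x, hx0, rfl⟩
  exact (hμ.eq_of_smoothed_eq hx0 (Function.invFunOn_mem he) (hμ.smoothed_pos hx)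
    (Function.invFunOn_eq he).symm).symm

theorem IsGenerator.hasDerivAt_smoothedInv (hμ : IsGenerator μ y₀) {x : ℝ}
    (hx : threshold y₀ < x) :
    HasDerivAt (smoothedInv μ y₀) (smoothedDeriv μ x)⁻¹ (smoothed μ x) := by
  have hinv := hμ.smoothedInv_smoothed hx.le
  have hmem : Ioi (smoothed μ (threshold y₀)) ∈ nhds (smoothed μ x) :=
    Ioi_mem_nhds (hμ.strictMonoOn_smoothed (mem_Ici.mpr le_rfl) hx.le hx)
  have hmono : StrictMonoOn (smoothedInv μ y₀) (Ioi (smoothed μ (threshold y₀))) := by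
    intro v hv w hw hvw
    obtain ⟨x, hx, rfl⟩ := hμ.exists_smoothed_eq hv
    obtain ⟨z, hz, rfl⟩ := hμ.exists_smoothed_eq hw
    rw [hμ.smoothedInv_smoothed hx.le, hμ.smoothedInv_smoothed hz.le]
    exact (hμ.strictMonoOn_smoothed.lt_iff_lt hx.le hz.le).mp hvw
  have hcont : ContinuousAt (smoothedInv μ y₀) (smoothed μ x) := by
    refine hmono.continuousAt_of_image_mem_nhds hmem ?_
    rw [hinv]
    refine mem_of_superset (Ioi_mem_nhds hx) fun z hz => ?_
    exact ⟨smoothed μ z, hμ.strictMonoOn_smoothed (mem_Ici.mpr le_rfl) (mem_Ici.mpr (le_of_lt hz)) hz,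
      hμ.smoothedInv_smoothed (le_of_lt hz)⟩
  have hxy : y₀ < x := (lt_threshold y₀).trans hx
  have hx0 : 0 < x := hμ.pos.trans hxy
  refine HasDerivAt.of_local_left_inverse (f := smoothed μ) hcont ?_
    (smoothedDeriv_pos hx0.ne' (hμ.deriv_nonneg hxy)
      (hx0.trans_le (hμ.le_of_threshold_le hx.le))).ne' ?_
  · rw [hinv]
    exact hμ.hasDerivAt_smoothed hxy
  · filter_upwards [hmem] with v hv
    obtain ⟨z, hz, rfl⟩ := hμ.exists_smoothed_eq hv
    rw [hμ.smoothedInv_smoothed hz.le]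

theorem phi_eq (μ : ℝ → ℝ) (y₀ T : ℝ) : phi μ y₀ T = smoothedInv μ y₀ (hardyLittlewood T) := rfl

/-- The ratio of `dφ₁/dt` to `Z²(t)`. -/
noncomputable def ladderDensity (μ : ℝ → ℝ) (y₀ t : ℝ) : ℝ := 1 / (2 * smoothedDeriv μ (phi μ y₀ t))

/-- On `(b, ∞)` the function `g` is a smooth bijection onto `(c, ∞)` with inverse `gInv` and
derivative `Z² G`, where `G` is positive. -/
structure IsLadder (g gInv G : ℝ → ℝ) (b c : ℝ) : Prop where
  hasDerivAt : ∀ t, b < t → HasDerivAt g (hardyZ t ^ 2 * G t) t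
  density_pos : ∀ t, b < t → 0 < G t
  strictMonoOn : StrictMonoOn g (Ioi b)
  lt_apply : ∀ t, b < t → c < g t
  surj : ∀ s, c < s → ∃ t, b < t ∧ g t = s
  left_inv : ∀ t, b < t → gInv (g t) = t

/-- The point b solves `hardyLittlewood b` = `smoothed μ (threshold y₀)`. Beyond it φ is a
composition of two increasing bijections between half-lines, with derivative Z²/S'(φ). -/
theorem IsGenerator.exists_isLadder (hμ : IsGenerator μ y₀) :
    ∃ b, (∀ t, b < t → 0 < t ∧ threshold y₀ < phi μ y₀ t ∧
        smoothed μ (phi μ y₀ t) = hardyLittlewood t) ∧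
      IsLadder (phi₁ μ y₀) (phi₁Inv μ y₀) (ladderDensity μ y₀) b (threshold y₀ / 2) := by
  have hθ := hμ.smoothed_pos (x := threshold y₀) le_rfl
  obtain ⟨b, hb0, hb⟩ : ∃ b, 0 < b ∧ hardyLittlewood b = smoothed μ (threshold y₀) := by
    obtain ⟨X, hX1, hX2⟩ := ((tendsto_hardyLittlewood.eventually_gt_atTop
      (smoothed μ (threshold y₀))).and (eventually_gt_atTop 0)).exists
    obtain ⟨b, hb, hbv⟩ := intermediate_value_Ioo hX2.le
      continuous_hardyLittlewood.continuousOn ⟨by rwa [hardyLittlewood_zero], hX1⟩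
    exact ⟨b, hb.1, hbv⟩
  have key : ∀ t, b < t → ∃ x, threshold y₀ < x ∧ smoothed μ x = hardyLittlewood t ∧
      phi μ y₀ t = x := by
    intro t ht
    obtain ⟨x, hx, hxt⟩ := hμ.exists_smoothed_eq (v := hardyLittlewood t)
      (by rw [← hb]; exact strictMono_hardyLittlewood ht)
    refine ⟨x, hx, hxt, ?_⟩
    rw [phi_eq, ← hxt, hμ.smoothedInv_smoothed hx.le]
  -- Injectivity is needed on the whole domain, from which `phi₁Inv` chooses: the value φ(T)
  -- determines ∫_0^T Z², hence T.
  have hinj : InjOn (phi₁ μ y₀) (domain μ y₀) := by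
    have h : ∀ t ∈ domain μ y₀, smoothed μ (phi μ y₀ t) = hardyLittlewood t := fun t ht =>
      Function.invFunOn_eq ht.2
    intro s hs t ht hst
    have hst' : phi μ y₀ s = phi μ y₀ t := by
      unfold phi₁ at hst
      linarith
    refine strictMono_hardyLittlewood.injective ?_
    rw [← h s hs, ← h t ht, hst']
  refine ⟨b, fun t ht => ?_, ?_, ?_, ?_, ?_, ?_, ?_⟩
  · obtain ⟨x, hx, hxt, hφ⟩ := key t ht
    rw [hφ]
    exact ⟨hb0.trans ht, hx, hxt⟩
  · intro t ht
    obtain ⟨x, hx, hxt, hφ⟩ := key t ht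
    have h1 := hμ.hasDerivAt_smoothedInv hx
    rw [hxt] at h1
    have h2 := (h1.comp t (hasDerivAt_hardyLittlewood t)).div_const 2
    refine h2.congr_deriv ?_
    rw [ladderDensity, hφ]
    ring
  · intro t ht
    obtain ⟨x, hx, hxt, hφ⟩ := key t ht
    have hxy : y₀ < x := (lt_threshold y₀).trans hx
    have hx0 : 0 < x := hμ.pos.trans hxy
    have := smoothedDeriv_pos hx0.ne' (hμ.deriv_nonneg hxy)
      (hx0.trans_le (hμ.le_of_threshold_le hx.le))
    rw [ladderDensity, hφ]
    positivity
  · intro s hs t ht hst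
    obtain ⟨x, hx, hxs, hφs⟩ := key s hs
    obtain ⟨z, hz, hzt, hφt⟩ := key t ht
    have : x < z := by
      rw [← hμ.strictMonoOn_smoothed.lt_iff_lt hx.le hz.le, hxs, hzt]
      exact strictMono_hardyLittlewood hst
    rw [phi₁, phi₁, hφs, hφt]
    linarith
  · intro t ht
    obtain ⟨x, hx, hxt, hφ⟩ := key t ht
    rw [phi₁, hφ]
    linarith
  · intro s hs
    have hs2 : threshold y₀ < 2 * s := by linarith
    have hlt := hμ.strictMonoOn_smoothed (mem_Ici.mpr le_rfl) hs2.le hs2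
    obtain ⟨X, hX1, hX2⟩ := ((tendsto_hardyLittlewood.eventually_gt_atTop
      (smoothed μ (2 * s))).and (eventually_gt_atTop b)).exists
    obtain ⟨t, ht, htv⟩ := intermediate_value_Ioo hX2.le
      continuous_hardyLittlewood.continuousOn ⟨by rwa [hb], hX1⟩
    refine ⟨t, ht.1, ?_⟩
    rw [phi₁, phi_eq, htv, hμ.smoothedInv_smoothed hs2.le]
    ring
  · intro t ht
    have hdom : t ∈ domain μ y₀ := by
      obtain ⟨x, hx, hxt, -⟩ := key t ht
      exact ⟨hb0.trans ht, x, (lt_threshold y₀).le.trans hx.le, hxt⟩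
    exact hinj.leftInvOn_invFunOn hdom

end JacobLadder

/-! ### Change of variables, and iteration of a ladder -/

namespace JacobLadder

section ChangeOfVariables

variable {v w : ℝ → ℝ} {a b κ : ℝ}

theorem integrableOn_weight_of_hasDerivWithinAt (hκ : 0 < κ)
    (hv : ∀ t ∈ Icc a b, HasDerivWithinAt v (κ * w t) (Icc a b) t)
    (hw : ∀ t ∈ Icc a b, 0 ≤ w t) (hinj : InjOn v (Icc a b)) (himg : v '' Icc a b = Icc a b) :
    IntegrableOn w (Icc a b) := by
  have h := (integrableOn_image_iff_integrableOn_abs_deriv_smul measurableSet_Icc hv hinj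
    (fun _ => (1 : ℝ))).mp (by rw [himg]; exact integrableOn_const (by simp))
  refine Integrable.congr (Integrable.const_mul h κ⁻¹)
    ((ae_restrict_iff' measurableSet_Icc).mpr (.of_forall fun t ht => ?_))
  simp only [smul_eq_mul, mul_one]
  rw [abs_of_nonneg (mul_nonneg hκ.le (hw t ht)), inv_mul_cancel_left₀ hκ.ne']

/-- No integrability of h is required: both sides take the default value 0 together. -/
theorem integral_comp_mul_weight (hab : a ≤ b) (hκ : 0 < κ)
    (hv : ∀ t ∈ Icc a b, HasDerivWithinAt v (κ * w t) (Icc a b) t)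
    (hw : ∀ t ∈ Icc a b, 0 ≤ w t) (hinj : InjOn v (Icc a b)) (himg : v '' Icc a b = Icc a b)
    (h : ℝ → ℝ) : ∫ t in a..b, h (v t) * w t = κ⁻¹ * ∫ t in a..b, h t := by
  rw [intervalIntegral.integral_of_le hab, intervalIntegral.integral_of_le hab,
    ← integral_Icc_eq_integral_Ioc, ← integral_Icc_eq_integral_Ioc]
  conv_rhs => rw [← himg]
  rw [integral_image_eq_integral_abs_deriv_smul measurableSet_Icc hv hinj, ← integral_const_mul]
  refine setIntegral_congr_fun measurableSet_Icc fun t ht => ?_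
  simp only [smul_eq_mul]
  rw [abs_of_nonneg (mul_nonneg hκ.le (hw t ht)), mul_assoc, inv_mul_cancel_left₀ hκ.ne', mul_comm]

/-- The map v pushes the measure κw dt forward to Lebesgue measure on [a, b]; the factor κ does not
affect membership in L^p. -/
theorem memLp_comp_withDensity (hκ : 0 < κ)
    (hv : ∀ t ∈ Icc a b, HasDerivWithinAt v (κ * w t) (Icc a b) t)
    (hw : ∀ t ∈ Icc a b, 0 ≤ w t) (hinj : InjOn v (Icc a b)) (himg : v '' Icc a b = Icc a b)
    {h : ℝ → ℝ} {p : ENNReal} (hh : MemLp h p (volume.restrict (Icc a b))) :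
    MemLp (fun t => h (v t)) p
      ((volume.restrict (Icc a b)).withDensity fun t => ENNReal.ofReal (w t)) := by
  set ν := (volume.restrict (Icc a b)).withDensity fun t => ENNReal.ofReal |κ * w t| with hν
  have hmap : Measure.map v ν = volume.restrict (Icc a b) := by
    have := map_withDensity_abs_det_fderiv_eq_addHaar volume measurableSet_Icc.nullMeasurableSet
      (fun t ht => (hv t ht).hasFDerivWithinAt) hinj
    simpa only [himg, ContinuousLinearMap.det_toSpanSingleton] using this
  have hvm : AEMeasurable v ν := by
    have hc : ContinuousOn v (Icc a b) := fun t ht => (hv t ht).continuousWithinAt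
    exact (hc.aemeasurable measurableSet_Icc).mono_ac (withDensity_absolutelyContinuous _ _)
  have h1 : MemLp (h ∘ v) p ν := MemLp.comp_of_map (by rwa [hmap]) hvm
  refine h1.of_measure_le_smul (c := ENNReal.ofReal κ⁻¹) ENNReal.ofReal_ne_top (le_of_eq ?_)
  rw [hν, ← withDensity_smul' _ _ ENNReal.ofReal_ne_top]
  refine withDensity_congr_ae ((ae_restrict_iff' measurableSet_Icc).mpr (.of_forall fun t ht => ?_))
  simp only [Pi.smul_apply, smul_eq_mul]
  rw [← ENNReal.ofReal_mul (inv_nonneg.mpr hκ.le),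
    abs_of_nonneg (mul_nonneg hκ.le (hw t ht)), inv_mul_cancel_left₀ hκ.ne']

end ChangeOfVariables

namespace IsLadder

variable {g gInv G : ℝ → ℝ} {b c : ℝ}

theorem lt_inv (h : IsLadder g gInv G b c) {s : ℝ} (hs : c < s) : b < gInv s := by
  obtain ⟨t, ht, rfl⟩ := h.surj s hs
  rwa [h.left_inv t ht]

theorem right_inv (h : IsLadder g gInv G b c) {s : ℝ} (hs : c < s) : g (gInv s) = s := by
  obtain ⟨t, ht, rfl⟩ := h.surj s hs
  rw [h.left_inv t ht]

theorem strictMonoOn_inv (h : IsLadder g gInv G b c) : StrictMonoOn gInv (Ioi c) := by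
  intro s hs t ht hst
  rw [← h.strictMonoOn.lt_iff_lt (h.lt_inv hs) (h.lt_inv ht), h.right_inv hs, h.right_inv ht]
  exact hst

theorem tendsto_inv (h : IsLadder g gInv G b c) : Tendsto gInv atTop atTop := by
  refine tendsto_atTop.mpr fun M => ?_
  have hM : b < max M (b + 1) := (lt_add_one b).trans_le (le_max_right _ _)
  filter_upwards [eventually_gt_atTop (g (max M (b + 1)))] with s hs
  have hc := h.lt_apply _ hM
  have := h.strictMonoOn_inv hc (hc.trans hs) hs
  rw [h.left_inv _ hM] at this
  exact (le_max_left _ _).trans this.le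

theorem tendsto_iterate_inv (h : IsLadder g gInv G b c) (p : ℕ) :
    Tendsto gInv^[p] atTop atTop := h.tendsto_inv.iterate p

theorem eventually_lt_iterate_inv (h : IsLadder g gInv G b c) (p : ℕ) (M : ℝ) :
    ∀ᶠ T in atTop, ∀ r ∈ Finset.range (p + 1), M < gInv^[r] T :=
  (Filter.eventually_all_finset _).mpr fun r _ =>
    (h.tendsto_iterate_inv r).eventually_gt_atTop M

variable {p : ℕ} {S T : ℝ}

theorem iterate_inv_lt (h : IsLadder g gInv G b c) (hST : S < T)
    (hS : ∀ r ∈ Finset.range (p + 1), max b c < gInv^[r] S) {r : ℕ} (hr : r ≤ p) :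
    gInv^[r] S < gInv^[r] T := by
  induction r with
  | zero => exact hST
  | succ r ih =>
    have h1 : c < gInv^[r] S :=
      (le_max_right b c).trans_lt (hS r (Finset.mem_range.mpr (by omega)))
    have h2 := ih (by omega)
    rw [Function.iterate_succ_apply', Function.iterate_succ_apply']
    exact h.strictMonoOn_inv h1 (h1.trans h2) h2

theorem apply_iterate_inv_succ (h : IsLadder g gInv G b c) {r : ℕ} (hr : c < gInv^[r] T) :
    g (gInv^[r + 1] T) = gInv^[r] T := by
  rw [Function.iterate_succ_apply', h.right_inv hr]

/-- Each application of g cancels one inverse at both endpoints. The lower bounds on the points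
`gInv^[r] S` keep the orbit inside the half-line where g is monotone. -/
theorem iterate_mem_Icc (h : IsLadder g gInv G b c) (hST : S < T)
    (hS : ∀ r ∈ Finset.range (p + 1), max b c < gInv^[r] S) {u : ℝ}
    (hu : u ∈ Icc (gInv^[p] S) (gInv^[p] T)) {r : ℕ} (hr : r ≤ p) :
    g^[r] u ∈ Icc (gInv^[p - r] S) (gInv^[p - r] T) := by
  induction r with
  | zero => exact hu
  | succ r ih =>
    obtain ⟨h1, h2⟩ := ih (by omega)
    obtain ⟨q, hq⟩ : ∃ q, p - r = q + 1 := ⟨p - (r + 1), by omega⟩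
    have hq' : p - (r + 1) = q := by omega
    rw [hq] at h1 h2
    rw [hq', Function.iterate_succ_apply']
    have hmem : ∀ j ≤ p, max b c < gInv^[j] S := fun j hj =>
      hS j (Finset.mem_range.mpr (by omega))
    have h3 := (le_max_left b c).trans_lt (hmem (q + 1) (by omega))
    have h4 := (le_max_right b c).trans_lt (hmem q (by omega))
    have h5 := h4.trans (h.iterate_inv_lt hST hS (show q ≤ p by omega))
    rw [← h.apply_iterate_inv_succ h4, ← h.apply_iterate_inv_succ h5]
    have h6 : b < g^[r] u := h3.trans_le h1
    exact ⟨h.strictMonoOn.monotoneOn h3 h6 h1, h.strictMonoOn.monotoneOn h6 (h6.trans_le h2) h2⟩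

theorem lt_iterate (h : IsLadder g gInv G b c) (hST : S < T)
    (hS : ∀ r ∈ Finset.range (p + 1), max b c < gInv^[r] S) {u : ℝ}
    (hu : u ∈ Icc (gInv^[p] S) (gInv^[p] T)) {r : ℕ} (hr : r ≤ p) : b < g^[r] u :=
  ((le_max_left b c).trans_lt (hS (p - r) (Finset.mem_range.mpr (by omega)))).trans_le
    (h.iterate_mem_Icc hST hS hu hr).1

theorem iterate_iterate_inv (h : IsLadder g gInv G b c)
    (hS : ∀ r < p, c < gInv^[r] S) : g^[p] (gInv^[p] S) = S := by
  induction p with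
  | zero => rfl
  | succ p ih =>
    rw [Function.iterate_succ_apply, h.apply_iterate_inv_succ (hS p (Nat.lt_succ_self p))]
    exact ih fun r hr => hS r (hr.trans (Nat.lt_succ_self p))

/-- The chain rule along the orbit; this product is the origin of the weight. -/
theorem hasDerivAt_iterate (h : IsLadder g gInv G b c) {u : ℝ} {r : ℕ}
    (hu : ∀ j < r, b < g^[j] u) :
    HasDerivAt g^[r] (∏ j ∈ Finset.range r, deriv g (g^[j] u)) u := by
  induction r with
  | zero => simpa using hasDerivAt_id u
  | succ r ih =>
    have h1 := ih fun j hj => hu j (hj.trans (Nat.lt_succ_self r))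
    have h2 := (h.hasDerivAt _ (hu r (Nat.lt_succ_self r))).differentiableAt.hasDerivAt
    rw [Finset.prod_range_succ, mul_comm, Function.iterate_succ']
    exact h2.comp u h1

theorem strictMonoOn_iterate (h : IsLadder g gInv G b c) (hST : S < T)
    (hS : ∀ r ∈ Finset.range (p + 1), max b c < gInv^[r] S) {r : ℕ} (hr : r ≤ p) :
    StrictMonoOn g^[r] (Icc (gInv^[p] S) (gInv^[p] T)) := by
  induction r with
  | zero => exact strictMono_id.strictMonoOn _
  | succ r ih =>
    intro u hu v hv huv
    rw [Function.iterate_succ_apply', Function.iterate_succ_apply']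
    exact h.strictMonoOn (h.lt_iterate hST hS hu (by omega)) (h.lt_iterate hST hS hv (by omega))
      (ih (by omega) hu hv huv)

end IsLadder

end JacobLadder

/-! ### The weight, the substitution, and transfer of orthogonality -/

namespace JacobLadder

variable {μ : ℝ → ℝ} {y₀ : ℝ} {G : ℝ → ℝ} {b c a l : ℝ} {p : ℕ} {T : ℝ}

theorem affine_left (μ : ℝ → ℝ) (y₀ a l : ℝ) (p : ℕ) (T : ℝ) :
    affine μ y₀ a l p T a = reverseIter μ y₀ p T := by
  simp [affine]

theorem affine_right (μ : ℝ → ℝ) (y₀ a : ℝ) {l : ℝ} (hl : 0 < l) (p : ℕ) (T : ℝ) :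
    affine μ y₀ a l p T (a + 2 * l) = reverseIter μ y₀ p (T + 2 * l) := by
  simp only [affine, add_sub_cancel_left]
  rw [div_mul_cancel₀ _ (by positivity)]
  ring

section

variable (h : IsLadder (phi₁ μ y₀) (phi₁Inv μ y₀) G b c) (hl : 0 < l)
  (hT : ∀ r ∈ Finset.range (p + 1), max b c < (phi₁Inv μ y₀)^[r] T)

include h hl hT

theorem IsLadder.slope_pos :
    0 < (reverseIter μ y₀ p (T + 2 * l) - reverseIter μ y₀ p T) / (2 * l) :=
  div_pos (sub_pos.mpr (h.iterate_inv_lt (by linarith) hT le_rfl)) (by positivity)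

theorem IsLadder.strictMono_affine : StrictMono (affine μ y₀ a l p T) := fun s t hst => by
  have := h.slope_pos hl hT
  simp only [affine]
  gcongr

theorem IsLadder.affine_mem {t : ℝ} (ht : t ∈ Icc a (a + 2 * l)) :
    affine μ y₀ a l p T t
      ∈ Icc ((phi₁Inv μ y₀)^[p] T) ((phi₁Inv μ y₀)^[p] (T + 2 * l)) := by
  have hm := (h.strictMono_affine (a := a) hl hT).monotone
  exact ⟨(affine_left μ y₀ a l p T).ge.trans (hm ht.1),
    (hm ht.2).trans (affine_right μ y₀ a hl p T).le⟩

theorem IsLadder.lt_orbit {t : ℝ} (ht : t ∈ Icc a (a + 2 * l)) {r : ℕ} (hr : r ≤ p) :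
    b < (phi₁ μ y₀)^[r] (affine μ y₀ a l p T t) :=
  h.lt_iterate (by linarith) hT (h.affine_mem hl hT ht) hr

theorem IsLadder.weight_eq {t : ℝ} (ht : t ∈ Icc a (a + 2 * l)) :
    weight μ y₀ a l p T t = ∏ r ∈ Finset.range p,
      (hardyZ ((phi₁ μ y₀)^[r] (affine μ y₀ a l p T t)) ^ 2
        * G ((phi₁ μ y₀)^[r] (affine μ y₀ a l p T t))) :=
  Finset.prod_congr rfl fun _ hr =>
    (h.hasDerivAt _ (h.lt_orbit hl hT ht (Finset.mem_range.mp hr).le)).deriv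

theorem IsLadder.weight_nonneg {t : ℝ} (ht : t ∈ Icc a (a + 2 * l)) :
    0 ≤ weight μ y₀ a l p T t := by
  rw [h.weight_eq hl hT ht]
  exact Finset.prod_nonneg fun r hr => mul_nonneg (sq_nonneg _)
    (h.density_pos _ (h.lt_orbit hl hT ht (Finset.mem_range.mp hr).le)).le

theorem IsLadder.injOn_orbit {r : ℕ} (hr : r ≤ p) :
    StrictMonoOn (fun t => (phi₁ μ y₀)^[r] (affine μ y₀ a l p T t)) (Icc a (a + 2 * l)) :=
  fun _ hs _ ht hst => h.strictMonoOn_iterate (by linarith) hT hr (h.affine_mem hl hT hs)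
    (h.affine_mem hl hT ht) (h.strictMono_affine hl hT hst)

/-- A factor vanishes only when its orbit map meets a zero of Z. Each orbit map is injective, so the
exceptional set is a finite union of countable sets. -/
theorem IsLadder.ae_weight_pos :
    ∀ᵐ t ∂(volume.restrict (Icc a (a + 2 * l))), 0 < weight μ y₀ a l p T t := by
  rw [ae_restrict_iff' measurableSet_Icc]
  have hc : (⋃ r ∈ Finset.range p, Icc a (a + 2 * l) ∩
      (fun t => (phi₁ μ y₀)^[r] (affine μ y₀ a l p T t)) ⁻¹' {s | hardyZ s ^ 2 = 0}).Countable := by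
    refine (Finset.range p).countable_toSet.biUnion fun r hr => ?_
    have hr' : r ≤ p := (Finset.mem_range.mp hr).le
    refine MapsTo.countable_of_injOn (t := {s | hardyZ s ^ 2 = 0}) (fun t ht => ht.2)
      ((h.injOn_orbit hl hT hr').injOn.mono inter_subset_left) countable_hardyZ_zeros
  filter_upwards [hc.ae_notMem volume] with t ht htI
  rw [h.weight_eq hl hT htI]
  refine Finset.prod_pos fun r hr => mul_pos (lt_of_le_of_ne (sq_nonneg _) fun h0 => ht ?_)
    (h.density_pos _ (h.lt_orbit hl hT htI (Finset.mem_range.mp hr).le))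
  exact mem_biUnion hr ⟨htI, h0.symm⟩

theorem IsLadder.hasDerivAt_substitution {t : ℝ} (ht : t ∈ Icc a (a + 2 * l)) :
    HasDerivAt (fun t => (phi₁ μ y₀)^[p] (affine μ y₀ a l p T t) - T + a)
      ((reverseIter μ y₀ p (T + 2 * l) - reverseIter μ y₀ p T) / (2 * l)
        * weight μ y₀ a l p T t) t := by
  have h1 : HasDerivAt (affine μ y₀ a l p T)
      ((reverseIter μ y₀ p (T + 2 * l) - reverseIter μ y₀ p T) / (2 * l)) t := by
    exact ((((hasDerivAt_id t).sub_const a).const_mul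
      ((reverseIter μ y₀ p (T + 2 * l) - reverseIter μ y₀ p T) / (2 * l))).add_const
      (reverseIter μ y₀ p T)).congr_deriv (mul_one _)
  have h2 := h.hasDerivAt_iterate (u := affine μ y₀ a l p T t) (r := p)
    fun j hj => h.lt_orbit hl hT ht hj.le
  refine (((h2.comp t h1).sub_const T).add_const a).congr_deriv ?_
  rw [mul_comm]
  rfl

theorem IsLadder.injOn_substitution :
    InjOn (fun t => (phi₁ μ y₀)^[p] (affine μ y₀ a l p T t) - T + a) (Icc a (a + 2 * l)) :=
  fun s hs t ht hst => (h.injOn_orbit hl hT le_rfl).injOn hs ht (by simpa using hst)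

/-- The substitution fixes both endpoints, because φ₁^p undoes φ₁^{-p} at T and at T + 2l;
monotonicity and the intermediate value theorem give the rest. -/
theorem IsLadder.image_substitution :
    (fun t => (phi₁ μ y₀)^[p] (affine μ y₀ a l p T t) - T + a) '' Icc a (a + 2 * l)
      = Icc a (a + 2 * l) := by
  have hlt : T < T + 2 * l := by linarith
  have hle : a ≤ a + 2 * l := by linarith
  have hc : ∀ r < p, c < (phi₁Inv μ y₀)^[r] T := fun r hr =>
    (le_max_right b c).trans_lt (hT r (Finset.mem_range.mpr (by omega)))
  have e1 : (phi₁ μ y₀)^[p] (affine μ y₀ a l p T a) - T + a = a := by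
    rw [affine_left, reverseIter, h.iterate_iterate_inv hc]
    ring
  have e2 : (phi₁ μ y₀)^[p] (affine μ y₀ a l p T (a + 2 * l)) - T + a = a + 2 * l := by
    rw [affine_right μ y₀ a hl, reverseIter, h.iterate_iterate_inv fun r hr =>
      (hc r hr).trans (h.iterate_inv_lt hlt hT hr.le)]
    ring
  refine Subset.antisymm ?_ ?_
  · rintro _ ⟨t, ht, rfl⟩
    have hm := (h.injOn_orbit (a := a) hl hT le_rfl).monotoneOn
    have h1 := hm (left_mem_Icc.mpr hle) ht ht.1
    have h2 := hm ht (right_mem_Icc.mpr hle) ht.2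
    simp only at h1 h2
    exact ⟨by linarith, by linarith⟩
  · have := intermediate_value_Icc (f := fun t =>
      (phi₁ μ y₀)^[p] (affine μ y₀ a l p T t) - T + a) hle fun t ht =>
      (h.hasDerivAt_substitution hl hT ht).continuousAt.continuousWithinAt
    simpa only [e1, e2] using this

theorem IsLadder.isWeight : IsWeight (weight μ y₀ a l p T) a (a + 2 * l) where
  nonneg _ ht := h.weight_nonneg hl hT ht
  pos := h.ae_weight_pos hl hT
  integrable := integrableOn_weight_of_hasDerivWithinAt (h.slope_pos hl hT)
    (fun _ ht => (h.hasDerivAt_substitution hl hT ht).hasDerivWithinAt)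
    (fun _ ht => h.weight_nonneg hl hT ht) (h.injOn_substitution hl hT)
    (h.image_substitution hl hT)

theorem IsLadder.integral_substitution (F : ℝ → ℝ) :
    ∫ t in a..(a + 2 * l), F ((phi₁ μ y₀)^[p] (affine μ y₀ a l p T t) - T + a)
        * weight μ y₀ a l p T t
      = ((reverseIter μ y₀ p (T + 2 * l) - reverseIter μ y₀ p T) / (2 * l))⁻¹
        * ∫ t in a..(a + 2 * l), F t :=
  integral_comp_mul_weight (by linarith) (h.slope_pos hl hT)
    (fun _ ht => (h.hasDerivAt_substitution hl hT ht).hasDerivWithinAt)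
    (fun _ ht => h.weight_nonneg hl hT ht) (h.injOn_substitution hl hT)
    (h.image_substitution hl hT) F

theorem IsLadder.isOrthogonalSystem {f : ℕ → ℝ → ℝ}
    (hf : IsOrthogonalSystem (fun _ => 1) a (a + 2 * l) f) :
    IsOrthogonalSystem (weight μ y₀ a l p T) a (a + 2 * l) (iterated μ y₀ a l f p T) where
  memLp n := by
    have hn : MemLp (f n) 2 (volume.restrict (Icc a (a + 2 * l))) := by
      have := hf.memLp n
      rw [ENNReal.ofReal_one] at this
      change MemLp (f n) 2 ((volume.restrict (Icc a (a + 2 * l))).withDensity 1) at this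
      rwa [withDensity_one] at this
    exact memLp_comp_withDensity (h.slope_pos hl hT)
      (fun _ ht => (h.hasDerivAt_substitution hl hT ht).hasDerivWithinAt)
      (fun _ ht => h.weight_nonneg hl hT ht) (h.injOn_substitution hl hT)
      (h.image_substitution hl hT) hn
  orthogonal m n hmn := by
    have h1 := hf.orthogonal m n hmn
    simp only [mul_one] at h1
    have h2 := h.integral_substitution (a := a) hl hT fun t => f m t * f n t
    rw [h1, mul_zero] at h2
    exact h2

theorem IsLadder.integral_iterated_sq_ne_zero {f : ℕ → ℝ → ℝ} {n : ℕ}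
    (hn : (∫ t in a..(a + 2 * l), f n t ^ 2) ≠ 0) :
    (∫ t in a..(a + 2 * l),
      iterated μ y₀ a l f p T n t ^ 2 * weight μ y₀ a l p T t) ≠ 0 := by
  have h2 := h.integral_substitution (a := a) hl hT fun t => f n t ^ 2
  have h3 : (∫ t in a..(a + 2 * l), iterated μ y₀ a l f p T n t ^ 2 * weight μ y₀ a l p T t)
      = _ := h2
  rw [h3]
  exact mul_ne_zero (inv_ne_zero (h.slope_pos hl hT).ne') hn

end

end JacobLadder

/-! ### Logarithms along orbits and the asymptotics of the weights -/

namespace JacobLadder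

/-- Each variable is bounded by the other up to a logarithmic factor, which adds only ln ln + O(1)
to the logarithm. -/
theorem tendsto_log_div_log {x : ℝ → ℝ} (hx : Tendsto x atTop atTop) {C : ℝ} (hC : 0 < C)
    (h1 : ∀ᶠ t in atTop, x t ≤ C * (t * Real.log t))
    (h2 : ∀ᶠ t in atTop, t ≤ C * (x t * Real.log (x t))) :
    Tendsto (fun t => Real.log (x t) / Real.log t) atTop (nhds 1) := by
  set ε : ℝ → ℝ := fun s => (Real.log C + Real.log (Real.log s)) / Real.log s with hε
  have hε0 : Tendsto ε atTop (nhds 0) := by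
    have h3 : Tendsto (fun s => Real.log C / Real.log s) atTop (nhds 0) :=
      Real.tendsto_log_atTop.const_div_atTop _
    have h4 : Tendsto (fun s => Real.log (Real.log s) / Real.log s) atTop (nhds 0) :=
      (Real.isLittleO_log_id_atTop.comp_tendsto Real.tendsto_log_atTop).tendsto_div_nhds_zero
    simpa [hε, add_div] using h3.add h4
  have key : ∀ s r, 1 < s → 0 < r → r ≤ C * (s * Real.log s) →
      Real.log r ≤ Real.log s * (1 + ε s) := by
    intro s r hs hr hrs
    have hl := Real.log_pos hs
    have hs0 : 0 < s := by linarith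
    refine (Real.log_le_log hr hrs).trans_eq ?_
    rw [Real.log_mul hC.ne' (by positivity), Real.log_mul hs0.ne' hl.ne', hε]
    field_simp
    ring
  have hup : ∀ᶠ t in atTop, Real.log (x t) / Real.log t ≤ 1 + ε t := by
    filter_upwards [h1, eventually_gt_atTop 1, hx.eventually_gt_atTop 0] with t ht1 ht hxt
    rw [div_le_iff₀ (Real.log_pos ht), mul_comm]
    exact key t _ ht hxt ht1
  have hlo : ∀ᶠ t in atTop, (1 + ε (x t))⁻¹ ≤ Real.log (x t) / Real.log t := by
    filter_upwards [h2, eventually_gt_atTop 1, hx.eventually_gt_atTop 1] with t ht2 ht hxt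
    have h5 := key (x t) t hxt (by linarith) ht2
    have h6 := Real.log_pos ht
    have h7 := Real.log_pos hxt
    have h8 : 0 < 1 + ε (x t) := pos_of_mul_pos_right (h6.trans_le h5) h7.le
    rw [inv_eq_one_div, div_le_div_iff₀ h8 h6]
    linarith
  refine tendsto_of_tendsto_of_tendsto_of_le_of_le' ?_ ?_ hlo hup
  · simpa using ((hε0.comp hx).const_add 1).inv₀ (by simp)
  · simpa using hε0.const_add 1

theorem tendsto_log_add_div_log {d : ℝ} (hd : 0 ≤ d) :
    Tendsto (fun t => Real.log (t + d) / Real.log t) atTop (nhds 1) := by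
  refine tendsto_log_div_log (tendsto_atTop_add_const_right _ _ tendsto_id) two_pos ?_ ?_
  · filter_upwards [eventually_ge_atTop d, eventually_ge_atTop (Real.exp 1)] with t h1 h2
    have ht : 0 < t := (Real.exp_pos 1).trans_le h2
    have : 1 ≤ Real.log t := (Real.le_log_iff_exp_le ht).mpr h2
    nlinarith
  · filter_upwards [eventually_ge_atTop (Real.exp 1)] with t h2
    have ht : 0 < t := (Real.exp_pos 1).trans_le h2
    have : 1 ≤ Real.log (t + d) := (Real.le_log_iff_exp_le (by linarith)).mpr (by linarith)
    nlinarith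

namespace IsLadder

variable {g gInv G : ℝ → ℝ} {b c : ℝ}

theorem tendsto_apply (h : IsLadder g gInv G b c) : Tendsto g atTop atTop := by
  refine tendsto_atTop.mpr fun M => ?_
  have hM : c < max M (c + 1) := (lt_add_one c).trans_le (le_max_right _ _)
  filter_upwards [eventually_gt_atTop (gInv (max M (c + 1)))] with t ht
  have := h.strictMonoOn (h.lt_inv hM) ((h.lt_inv hM).trans ht) ht
  rw [h.right_inv hM] at this
  exact (le_max_left _ _).trans this.le

/-- The relation ln g(t) ~ ln t passes to the inverse on setting t = `gInv T`, and to iterates by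
multiplying the ratios. -/
theorem tendsto_log_iterate_inv (h : IsLadder g gInv G b c)
    (hg : Tendsto (fun t => Real.log (g t) / Real.log t) atTop (nhds 1)) (r : ℕ) :
    Tendsto (fun T => Real.log (gInv^[r] T) / Real.log T) atTop (nhds 1) := by
  have h1 : Tendsto (fun T => Real.log (gInv T) / Real.log T) atTop (nhds 1) := by
    have := (hg.comp h.tendsto_inv).inv₀ one_ne_zero
    rw [inv_one] at this
    refine this.congr' ?_
    filter_upwards [eventually_gt_atTop c] with T hT
    simp only [Function.comp_apply]
    rw [h.right_inv hT, inv_div]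
  induction r with
  | zero =>
    refine tendsto_const_nhds.congr' ?_
    filter_upwards [eventually_gt_atTop 1] with T hT
    exact (div_self (Real.log_pos hT).ne').symm
  | succ r ih =>
    have h2 := (h1.comp (h.tendsto_iterate_inv r)).mul ih
    rw [one_mul] at h2
    refine h2.congr' ?_
    filter_upwards [(h.tendsto_iterate_inv r).eventually_gt_atTop 1] with T hT
    simp only [Function.comp_apply]
    rw [div_mul_div_cancel₀ (Real.log_pos hT).ne', Function.iterate_succ_apply']

theorem tendsto_log_iterate_inv_add (h : IsLadder g gInv G b c)
    (hg : Tendsto (fun t => Real.log (g t) / Real.log t) atTop (nhds 1)) (r : ℕ) {d : ℝ}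
    (hd : 0 ≤ d) :
    Tendsto (fun T => Real.log (gInv^[r] (T + d)) / Real.log T) atTop (nhds 1) := by
  have h1 := ((h.tendsto_log_iterate_inv hg r).comp
    (tendsto_atTop_add_const_right atTop d tendsto_id)).mul (tendsto_log_add_div_log hd)
  rw [one_mul] at h1
  refine h1.congr' ?_
  filter_upwards [eventually_gt_atTop 1] with T hT
  simp only [Function.comp_apply, id]
  rw [div_mul_div_cancel₀ (Real.log_pos (by linarith)).ne']

end IsLadder

section

variable {μ : ℝ → ℝ} {y₀ : ℝ} {G : ℝ → ℝ} {b c a l : ℝ}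
  (h : IsLadder (phi₁ μ y₀) (phi₁Inv μ y₀) G b c) (hl : 0 < l)

include h

/-- Limits along the product of `atTop` with the principal filter of the interval are limits as T →
∞, uniform in t. -/
theorem IsLadder.eventually_orbit_mem (a l : ℝ) (p : ℕ) :
    ∀ᶠ z : ℝ × ℝ in atTop ×ˢ 𝓟 (Icc a (a + 2 * l)),
      (∀ r ∈ Finset.range (p + 1), max b c < (phi₁Inv μ y₀)^[r] z.1) ∧
        z.2 ∈ Icc a (a + 2 * l) :=
  (h.eventually_lt_iterate_inv p (max b c)).prod_mk (mem_principal_self _)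

include hl

theorem IsLadder.tendsto_orbit {p r : ℕ} (hr : r ≤ p) :
    Tendsto (fun z : ℝ × ℝ => (phi₁ μ y₀)^[r] (affine μ y₀ a l p z.1 z.2))
      (atTop ×ˢ 𝓟 (Icc a (a + 2 * l))) atTop := by
  refine tendsto_atTop_mono' _ ?_ ((h.tendsto_iterate_inv (p - r)).comp tendsto_fst)
  filter_upwards [h.eventually_orbit_mem a l p] with z hz
  exact (h.iterate_mem_Icc (by linarith) hz.1 (h.affine_mem hl hz.1 hz.2) hr).1

/-- The orbit is squeezed between the (p − r)-th inverse iterates of T and T + 2l, neither of which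
depends on t. -/
theorem IsLadder.tendsto_log_orbit
    (hg : Tendsto (fun t => Real.log (phi₁ μ y₀ t) / Real.log t) atTop (nhds 1))
    {p r : ℕ} (hr : r ≤ p) :
    Tendsto (fun z : ℝ × ℝ =>
      Real.log ((phi₁ μ y₀)^[r] (affine μ y₀ a l p z.1 z.2)) / Real.log z.1)
      (atTop ×ˢ 𝓟 (Icc a (a + 2 * l))) (nhds 1) := by
  have hfst : Tendsto (Prod.fst : ℝ × ℝ → ℝ) (atTop ×ˢ 𝓟 (Icc a (a + 2 * l))) atTop :=
    tendsto_fst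
  have hev : ∀ᶠ z : ℝ × ℝ in atTop ×ˢ 𝓟 (Icc a (a + 2 * l)),
      0 < Real.log z.1 ∧ 0 < (phi₁Inv μ y₀)^[p - r] z.1 ∧
      (phi₁ μ y₀)^[r] (affine μ y₀ a l p z.1 z.2)
        ∈ Icc ((phi₁Inv μ y₀)^[p - r] z.1) ((phi₁Inv μ y₀)^[p - r] (z.1 + 2 * l)) := by
    filter_upwards [h.eventually_orbit_mem a l p, hfst.eventually_gt_atTop 1,
      hfst.eventually ((h.tendsto_iterate_inv (p - r)).eventually_gt_atTop 0)] with z hz h1 h2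
    exact ⟨Real.log_pos h1, h2,
      h.iterate_mem_Icc (by linarith) hz.1 (h.affine_mem hl hz.1 hz.2) hr⟩
  refine tendsto_of_tendsto_of_tendsto_of_le_of_le'
    ((h.tendsto_log_iterate_inv hg (p - r)).comp hfst)
    ((h.tendsto_log_iterate_inv_add hg (p - r) (d := 2 * l) (by linarith)).comp hfst) ?_ ?_
  · filter_upwards [hev] with z hz
    exact div_le_div_of_nonneg_right (Real.log_le_log hz.2.1 hz.2.2.1) hz.1.le
  · filter_upwards [hev] with z hz
    exact div_le_div_of_nonneg_right
      (Real.log_le_log (hz.2.1.trans_le hz.2.2.1) hz.2.2.2) hz.1.le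

/-- If the density of the ladder is asymptotic to `1 / ln t`, then the weights are asymptotic to the
normalized zeta products. -/
theorem IsLadder.isEquivalent_weight
    (hg : Tendsto (fun t => Real.log (phi₁ μ y₀ t) / Real.log t) atTop (nhds 1))
    (hG : Tendsto (fun t => G t * Real.log t) atTop (nhds 1)) (p : ℕ) :
    Function.uncurry (weight μ y₀ a l p) ~[atTop ×ˢ 𝓟 (Icc a (a + 2 * l))]
      Function.uncurry (zetaWeight μ y₀ a l p) := by
  have hfst : Tendsto (Prod.fst : ℝ × ℝ → ℝ) (atTop ×ˢ 𝓟 (Icc a (a + 2 * l))) atTop :=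
    tendsto_fst
  -- A multiplicative factor is exhibited, not a quotient, because the zeta product may vanish. At
  -- an orbit point s each factor is G(s) ln s · (ln s / ln T)⁻¹.
  refine isEquivalent_iff_exists_eq_mul.mpr ⟨fun z => ∏ r ∈ Finset.range p,
    (G ((phi₁ μ y₀)^[r] (affine μ y₀ a l p z.1 z.2)) * Real.log z.1), ?_, ?_⟩
  · suffices h0 : Tendsto (fun z : ℝ × ℝ => ∏ r ∈ Finset.range p,
        (G ((phi₁ μ y₀)^[r] (affine μ y₀ a l p z.1 z.2)) * Real.log z.1))
        (atTop ×ˢ 𝓟 (Icc a (a + 2 * l))) (nhds (∏ _r ∈ Finset.range p, 1)) by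
      simpa using h0
    refine tendsto_finsetProd _ fun r hr => ?_
    have hr' : r ≤ p := (Finset.mem_range.mp hr).le
    have h1 := (hG.comp (h.tendsto_orbit (a := a) hl hr')).mul
      ((h.tendsto_log_orbit (a := a) hl hg hr').inv₀ one_ne_zero)
    rw [inv_one, one_mul] at h1
    refine h1.congr' ?_
    filter_upwards [(h.tendsto_orbit (a := a) hl hr').eventually_gt_atTop 1] with z hz
    have := (Real.log_pos hz).ne'
    simp only [Function.comp_apply]
    field_simp
  · filter_upwards [h.eventually_orbit_mem a l p, hfst.eventually_gt_atTop 1] with z hz h1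
    have hlog := (Real.log_pos h1).ne'
    simp only [Function.uncurry, Pi.mul_apply]
    rw [h.weight_eq hl hz.1 hz.2, zetaWeight, Finset.prod_mul_distrib, Finset.prod_mul_distrib,
      Finset.prod_const, Finset.card_range]
    simp_rw [hardyZ_sq]
    field_simp

end

end JacobLadder

/-! ### The generators μ(y) = αy ln y -/

namespace JacobLadder

theorem tendsto_zero_of_abs_le_div {F : ℝ → ℝ} {C : ℝ}
    (hF : ∀ᶠ x in atTop, |F x| ≤ C / x) : Tendsto F atTop (nhds 0) :=
  squeeze_zero_norm' hF (tendsto_id.const_div_atTop C)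

/-- Half of the exponent is evaluated at t = μ x; the other half, e^(−t/x), is the weight of the
moment at 2x. -/
theorem moment_tail_le {μ : ℝ → ℝ} {x : ℝ} (hx : 0 < x) (hμ : 0 ≤ μ x) :
    ∫ t in Ioi (μ x), t * hardyZ t ^ 2 * Real.exp (-(2 / x) * t)
      ≤ Real.exp (-(μ x / x)) * moment (2 * x) := by
  have hi1 := (integrableOn_moment (c := 2 / x) (by positivity)).mono_set (Ioi_subset_Ioi hμ)
  have hi2 := (integrableOn_moment (c := 2 / (2 * x)) (by positivity))
  have hi3 : IntegrableOn (fun t => Real.exp (-(μ x / x)) *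
      (t * hardyZ t ^ 2 * Real.exp (-(2 / (2 * x)) * t))) (Ioi 0) := Integrable.const_mul hi2 _
  rw [moment, ← integral_const_mul]
  refine (setIntegral_mono_on hi1 (hi3.mono_set (Ioi_subset_Ioi hμ))
    measurableSet_Ioi fun t ht => ?_).trans
    (setIntegral_mono_set hi3 ?_ (Ioi_subset_Ioi hμ).eventuallyLE)
  · have ht' : μ x < t := ht
    have ht0 : 0 < t := hμ.trans_lt ht'
    have h1 : Real.exp (-(2 / x) * t)
        ≤ Real.exp (-(μ x / x)) * Real.exp (-(2 / (2 * x)) * t) := by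
      rw [← Real.exp_add]
      gcongr
      have : μ x / x ≤ t / x := by gcongr
      have e1 : 2 / x * t = t / x + t / x := by ring
      have e2 : 2 / (2 * x) * t = t / x := by field_simp
      rw [neg_mul, neg_mul, e1, e2]
      linarith
    calc t * hardyZ t ^ 2 * Real.exp (-(2 / x) * t)
        ≤ t * hardyZ t ^ 2 * (Real.exp (-(μ x / x)) * Real.exp (-(2 / (2 * x)) * t)) := by
          gcongr
      _ = _ := by ring
  · refine (ae_restrict_iff' measurableSet_Ioi).mpr (.of_forall fun t ht => ?_)
    have ht0 : (0 : ℝ) < t := ht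
    have : 0 ≤ Real.exp (-(μ x / x)) * (t * hardyZ t ^ 2 * Real.exp (-(2 / (2 * x)) * t)) := by
      positivity
    exact this

theorem moment_nonneg (x : ℝ) : 0 ≤ moment x :=
  setIntegral_nonneg measurableSet_Ioi fun t ht => by
    have ht0 : (0 : ℝ) < t := ht
    positivity

variable {μ : ℝ → ℝ} {y₀ α : ℝ}

theorem exp_neg_mul_log {x : ℝ} (hx : 0 < x) (n : ℕ) :
    Real.exp (-(n * Real.log x)) = 1 / x ^ n := by
  rw [Real.exp_neg, ← Real.log_pow, Real.exp_log (by positivity), one_div]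

/-- Here e^(−μ(x)/x) = x^(−α) ≤ x^(−7), against a moment of at most (2x)³. -/
theorem eventually_moment_tail_le (hα : α ∈ Icc (7 : ℝ) 8)
    (hμ : ∀ y ∈ Ici y₀, μ y = α * y * Real.log y) :
    ∀ᶠ x in atTop, |2 / x ^ 2 * ∫ t in Ioi (μ x), t * hardyZ t ^ 2 * Real.exp (-(2 / x) * t)|
      ≤ 16 / x := by
  have h1 : ∀ᶠ x in atTop, moment (2 * x) ≤ (2 * x) ^ 3 := by
    have h2 := (tendsto_moment.eventually_lt_const (show (1 / 4 : ℝ) < 1 by norm_num))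
    filter_upwards [(tendsto_id.const_mul_atTop two_pos).eventually h2, eventually_gt_atTop 1]
      with x hx hx1
    have hl : 0 < Real.log (2 * x) := Real.log_pos (by linarith)
    have hl2 : Real.log (2 * x) ≤ 2 * x := Real.log_le_self (by positivity)
    simp only [id] at hx
    rw [div_lt_one (by positivity)] at hx
    calc moment (2 * x) ≤ (2 * x) ^ 2 * Real.log (2 * x) := hx.le
      _ ≤ (2 * x) ^ 2 * (2 * x) := by gcongr
      _ = _ := by ring
  filter_upwards [h1, eventually_gt_atTop 1, eventually_ge_atTop y₀] with x hm hx hxy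
  have hx0 : 0 < x := by linarith
  have hl : 0 < Real.log x := Real.log_pos hx
  have hμx := hμ x hxy
  have hμ0 : 0 ≤ μ x := by
    rw [hμx]
    have := hα.1
    positivity
  have htail := moment_tail_le hx0 hμ0
  have hnn : 0 ≤ ∫ t in Ioi (μ x), t * hardyZ t ^ 2 * Real.exp (-(2 / x) * t) :=
    setIntegral_nonneg measurableSet_Ioi fun t ht => by
      have ht0 : (0 : ℝ) < t := hμ0.trans_lt ht
      positivity
  have hexp : Real.exp (-(μ x / x)) ≤ 1 / x ^ 7 := by
    rw [← exp_neg_mul_log hx0]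
    gcongr
    rw [hμx, mul_right_comm, mul_div_assoc, div_self hx0.ne', mul_one]
    push_cast
    gcongr
    exact hα.1
  rw [abs_of_nonneg (by positivity)]
  calc 2 / x ^ 2 * ∫ t in Ioi (μ x), t * hardyZ t ^ 2 * Real.exp (-(2 / x) * t)
      ≤ 2 / x ^ 2 * (1 / x ^ 7 * (2 * x) ^ 3) := by
        gcongr
        exact htail.trans (mul_le_mul hexp hm (moment_nonneg _) (by positivity))
    _ = 16 / x ^ 6 := by field_simp; ring
    _ ≤ 16 / x := by
        gcongr
        exact le_self_pow₀ hx.le (by norm_num)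

/-- The exponential is at most x^(−14), while Z² ≤ 16(9x²)² and μ' ≤ 8x by α ≤ 8; 10368 = 16 · 81 ·
8. -/
theorem eventually_boundary_le (hα : α ∈ Icc (7 : ℝ) 8)
    (hμ : ∀ y ∈ Ici y₀, μ y = α * y * Real.log y) :
    ∀ᶠ x in atTop, |hardyZ (μ x) ^ 2 * Real.exp (-(2 / x) * μ x) * deriv μ x| ≤ 10368 / x := by
  obtain ⟨hα1, hα2⟩ := hα
  filter_upwards [eventually_gt_atTop 1, eventually_gt_atTop y₀] with x hx hxy
  have hx0 : 0 < x := by linarith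
  have hl : 0 < Real.log x := Real.log_pos hx
  have hl1 : Real.log x ≤ x - 1 := Real.log_le_sub_one_of_pos hx0
  have hμx := hμ x hxy.le
  have hμ0 : 0 < μ x := by
    rw [hμx]
    positivity
  have hd : deriv μ x = α * (Real.log x + 1) := by
    have he : μ =ᶠ[nhds x] fun y => α * y * Real.log y := by
      filter_upwards [Ioi_mem_nhds hxy] with y hy using hμ y (mem_Ioi.mp hy).le
    rw [he.deriv_eq]
    have h1 := ((hasDerivAt_id x).const_mul α).mul (Real.hasDerivAt_log hx0.ne')
    have h2 : HasDerivAt (fun y => α * y * Real.log y) (α * (Real.log x + 1)) x := by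
      refine h1.congr_deriv ?_
      simp only [id]
      field_simp
    exact h2.deriv
  have hexp : Real.exp (-(2 / x) * μ x) ≤ 1 / x ^ 14 := by
    rw [← exp_neg_mul_log hx0, neg_mul]
    refine Real.exp_le_exp.mpr (neg_le_neg ?_)
    rw [hμx, show 2 / x * (α * x * Real.log x) = 2 * α * Real.log x by field_simp]
    push_cast
    gcongr
    linarith
  have hμ2 : 1 + μ x ≤ 9 * x ^ 2 := by
    rw [hμx]
    have : α * x * Real.log x ≤ 8 * x * x := by
      gcongr
      linarith
    nlinarith
  have hZ : hardyZ (μ x) ^ 2 ≤ 16 * (9 * x ^ 2) ^ 2 :=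
    (hardyZ_sq_le hμ0).trans (by gcongr)
  have hd2 : deriv μ x ≤ 8 * x := by
    rw [hd]
    gcongr
    linarith
  have hd0 : 0 ≤ deriv μ x := by
    rw [hd]
    positivity
  rw [abs_of_nonneg (by positivity)]
  calc hardyZ (μ x) ^ 2 * Real.exp (-(2 / x) * μ x) * deriv μ x
      ≤ 16 * (9 * x ^ 2) ^ 2 * (1 / x ^ 14) * (8 * x) := by gcongr
    _ = 10368 / x ^ 9 := by field_simp; ring
    _ ≤ 10368 / x := by
        gcongr
        exact le_self_pow₀ hx.le (by norm_num)

theorem tendsto_smoothedDeriv_div_log (hα : α ∈ Icc (7 : ℝ) 8)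
    (hμ : ∀ y ∈ Ici y₀, μ y = α * y * Real.log y) :
    Tendsto (fun x => smoothedDeriv μ x / Real.log x) atTop (nhds (1 / 2)) := by
  have h1 := tendsto_zero_of_abs_le_div (eventually_moment_tail_le hα hμ)
  have h2 := tendsto_zero_of_abs_le_div (eventually_boundary_le hα hμ)
  have h3 := ((h2.sub h1).div_atTop Real.tendsto_log_atTop).add (tendsto_moment.const_mul 2)
  rw [show (0 : ℝ) + 2 * (1 / 4) = 1 / 2 by norm_num] at h3
  refine h3.congr' ?_
  filter_upwards [eventually_gt_atTop 1, eventually_ge_atTop y₀] with x hx hxy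
  have hx0 : 0 < x := by linarith
  have hl : 0 < Real.log x := Real.log_pos hx
  have hμ0 : 0 ≤ μ x := by
    rw [hμ x hxy]
    have := hα.1
    positivity
  have hi := integrableOn_moment (c := 2 / x) (by positivity)
  have hsplit := intervalIntegral.integral_interval_add_Ioi hi (hi.mono_set (Ioi_subset_Ioi hμ0))
  rw [smoothedDeriv, moment, ← hsplit]
  field_simp
  ring

/-- Growth of `smoothed μ` when `μ y = α y ln y`. -/
theorem IsGenerator.eventually_smoothed_bounds (hg : IsGenerator μ y₀) (hα : α ∈ Icc (7 : ℝ) 8)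
    (hμ : ∀ y ∈ Ici y₀, μ y = α * y * Real.log y) :
    ∀ᶠ x in atTop, x / 2 ≤ smoothed μ x ∧ smoothed μ x ≤ 2 * (x * Real.log x) := by
  have h1 := tendsto_smoothedDeriv_div_log hα hμ
  -- Beyond X the derivative lies between (ln x)/4 ≥ 1 and ln x; the mean value inequality on [X, x]
  -- then gives both bounds.
  obtain ⟨X, hX⟩ := eventually_atTop.mp
    (((h1.eventually_const_lt (show (1 / 4 : ℝ) < 1 / 2 by norm_num)).and
    (h1.eventually_lt_const (show (1 / 2 : ℝ) < 1 by norm_num))).and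
    ((Real.tendsto_log_atTop.eventually_ge_atTop 4).and
      ((eventually_ge_atTop (threshold y₀)).and (eventually_ge_atTop 1))))
  have hXθ := (hX X le_rfl).2.2.1
  have hX1 := (hX X le_rfl).2.2.2
  have hXy : y₀ < X := (lt_threshold y₀).trans_le hXθ
  have hSX := hg.smoothed_pos hXθ
  have hd : ∀ x, X ≤ x → 1 ≤ deriv (smoothed μ) x ∧ deriv (smoothed μ) x ≤ Real.log x := by
    intro x hx
    obtain ⟨⟨h2, h3⟩, h4, -⟩ := hX x hx
    have hl : 0 < Real.log x := by linarith
    rw [(hg.hasDerivAt_smoothed (hXy.trans_le hx)).deriv]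
    rw [lt_div_iff₀ hl] at h2
    rw [div_lt_one hl] at h3
    exact ⟨by linarith, h3.le⟩
  have hlog : ∀ᶠ x in atTop, smoothed μ X ≤ x * Real.log x :=
    (tendsto_id.atTop_mul_atTop₀ Real.tendsto_log_atTop).eventually_ge_atTop _
  filter_upwards [eventually_ge_atTop (2 * X), hlog] with x hx hxl
  have hXx : X ≤ x := by linarith
  have hcont : ContinuousOn (smoothed μ) (Icc X x) := fun z hz =>
    (hg.hasDerivAt_smoothed (hXy.trans_le hz.1)).continuousAt.continuousWithinAt
  have hdiff : DifferentiableOn ℝ (smoothed μ) (interior (Icc X x)) := fun z hz =>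
    (hg.hasDerivAt_smoothed (hXy.trans_le
      (interior_subset hz).1)).differentiableAt.differentiableWithinAt
  have hlow := (convex_Icc X x).mul_sub_le_image_sub_of_le_deriv hcont hdiff (C := 1)
    (fun z hz => (hd z (interior_subset hz).1).1) X (left_mem_Icc.mpr hXx) x
    (right_mem_Icc.mpr hXx) hXx
  have hup := (convex_Icc X x).image_sub_le_mul_sub_of_deriv_le hcont hdiff (C := Real.log x)
    (fun z hz => (hd z (interior_subset hz).1).2.trans
      (Real.log_le_log (by linarith [(interior_subset hz).1]) (interior_subset hz).2))
    X (left_mem_Icc.mpr hXx) x (right_mem_Icc.mpr hXx) hXx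
  have hl : 0 ≤ Real.log x := Real.log_nonneg (by linarith)
  constructor
  · linarith
  · nlinarith

/-- Upper bound: φ/2 ≤ S(φ) = ∫_0^t Z² ≤ e² S(t) ≤ 2e² t ln t. Lower bound: ∫_0^t Z² = S(φ) ≤
∫_0^{μ(φ)} Z², hence t ≤ μ(φ) = αφ ln φ. -/
theorem IsGenerator.tendsto_log_phi (hg : IsGenerator μ y₀) (hα : α ∈ Icc (7 : ℝ) 8)
    (hμ : ∀ y ∈ Ici y₀, μ y = α * y * Real.log y) :
    Tendsto (phi μ y₀) atTop atTop ∧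
      Tendsto (fun t => Real.log (phi μ y₀ t) / Real.log t) atTop (nhds 1) := by
  obtain ⟨b, hb, hL⟩ := hg.exists_isLadder
  have hφ : Tendsto (phi μ y₀) atTop atTop :=
    (hL.tendsto_apply.const_mul_atTop two_pos).congr fun t => by rw [phi₁]; ring
  have hS := hg.eventually_smoothed_bounds hα hμ
  -- The summand 4e² serves the upper bound on φ, and 8 ≥ α the lower one.
  refine ⟨hφ, tendsto_log_div_log (C := 8 + 4 * Real.exp 2) hφ (by positivity) ?_ ?_⟩
  · filter_upwards [hφ.eventually hS, hS, eventually_gt_atTop b,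
      eventually_ge_atTop (threshold y₀), eventually_gt_atTop 1] with t h1 h2 ht hθ ht1
    obtain ⟨ht0, -, he⟩ := hb t ht
    have h3 := hardyLittlewood_le_smoothed ht0 (hg.le_of_threshold_le hθ)
    have hl := Real.log_pos ht1
    rw [Real.exp_neg, inv_mul_le_iff₀ (Real.exp_pos 2)] at h3
    have h4 : hardyLittlewood t ≤ Real.exp 2 * (2 * (t * Real.log t)) :=
      h3.trans (by gcongr; exact h2.2)
    have h5 : 0 ≤ t * Real.log t := by positivity
    nlinarith [h1.1]
  · filter_upwards [eventually_gt_atTop b, hφ.eventually_gt_atTop 1] with t ht hφ1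
    obtain ⟨ht0, hθ, he⟩ := hb t ht
    have hφ0 : 0 < phi μ y₀ t := by linarith
    have h1 := smoothed_le_hardyLittlewood (μ := μ) hφ0
      (hφ0.le.trans (hg.le_of_threshold_le hθ.le))
    rw [he, strictMono_hardyLittlewood.le_iff_le, hμ _ ((lt_threshold y₀).le.trans hθ.le)] at h1
    have hl := Real.log_pos hφ1
    refine h1.trans ?_
    rw [mul_assoc]
    gcongr
    linarith [hα.2, Real.exp_pos 2]

theorem IsGenerator.tendsto_log_phi₁ (hg : IsGenerator μ y₀) (hα : α ∈ Icc (7 : ℝ) 8)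
    (hμ : ∀ y ∈ Ici y₀, μ y = α * y * Real.log y) :
    Tendsto (fun t => Real.log (phi₁ μ y₀ t) / Real.log t) atTop (nhds 1) := by
  obtain ⟨hφ, hlog⟩ := hg.tendsto_log_phi hα hμ
  have h := hlog.sub (Real.tendsto_log_atTop.const_div_atTop (Real.log 2))
  rw [sub_zero] at h
  refine h.congr' ?_
  filter_upwards [hφ.eventually_gt_atTop 0] with t ht
  rw [phi₁, Real.log_div ht.ne' two_ne_zero, sub_div]

theorem IsGenerator.tendsto_ladderDensity_mul_log (hg : IsGenerator μ y₀)
    (hα : α ∈ Icc (7 : ℝ) 8) (hμ : ∀ y ∈ Ici y₀, μ y = α * y * Real.log y) :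
    Tendsto (fun t => ladderDensity μ y₀ t * Real.log t) atTop (nhds 1) := by
  obtain ⟨hφ, hlog⟩ := hg.tendsto_log_phi hα hμ
  have h := (((tendsto_smoothedDeriv_div_log hα hμ).comp hφ).const_mul 2 |>.mul hlog).inv₀
    (by norm_num)
  rw [show ((2 : ℝ) * (1 / 2) * 1)⁻¹ = 1 by norm_num] at h
  refine h.congr' ?_
  filter_upwards [hφ.eventually_gt_atTop 1] with t ht
  have := (Real.log_pos ht).ne'
  simp only [Function.comp_apply]
  rw [ladderDensity, mul_assoc, div_mul_div_cancel₀ this, mul_inv, inv_div]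
  ring

end JacobLadder

/-- The differentiability clause ensures that every factor of the weight is a true derivative and
not the default value 0 of `deriv`. -/
theorem corollary1 (μ : ℝ → ℝ) (y₀ : ℝ) (hμ : JacobLadder.IsGenerator μ y₀)
    (a l : ℝ) (hl : 0 < l) (f : ℕ → ℝ → ℝ)
    (hf : JacobLadder.IsOrthogonalSystem (fun _ => 1) a (a + 2 * l) f) (k : ℕ) :
    (∀ᶠ T in atTop, ∀ p ∈ Finset.Icc 1 k,
      (∀ t ∈ Icc a (a + 2 * l), ∀ r ∈ Finset.range p, DifferentiableAt ℝ (JacobLadder.phi₁ μ y₀)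
        ((JacobLadder.phi₁ μ y₀)^[r] (JacobLadder.affine μ y₀ a l p T t))) ∧
      JacobLadder.IsWeight (JacobLadder.weight μ y₀ a l p T) a (a + 2 * l) ∧
      JacobLadder.IsOrthogonalSystem (JacobLadder.weight μ y₀ a l p T) a (a + 2 * l)
        (JacobLadder.iterated μ y₀ a l f p T) ∧
      ∀ n, (∫ t in a..(a + 2 * l), f n t ^ 2) ≠ 0 →
        (∫ t in a..(a + 2 * l),
          JacobLadder.iterated μ y₀ a l f p T n t ^ 2 * JacobLadder.weight μ y₀ a l p T t) ≠ 0) ∧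
    (∀ α ∈ Icc (7 : ℝ) 8, (∀ y ∈ Ici y₀, μ y = α * y * Real.log y) →
      ∀ p ∈ Finset.Icc 1 k,
        Function.uncurry (JacobLadder.weight μ y₀ a l p)
          ~[atTop ×ˢ 𝓟 (Icc a (a + 2 * l))]
        Function.uncurry (JacobLadder.zetaWeight μ y₀ a l p)) := by
  obtain ⟨b, -, hL⟩ := hμ.exists_isLadder
  refine ⟨(Filter.eventually_all_finset _).mpr fun p _ => ?_, fun α hα hμα p _ =>
    hL.isEquivalent_weight hl (hμ.tendsto_log_phi₁ hα hμα)
      (hμ.tendsto_ladderDensity_mul_log hα hμα) p⟩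
  filter_upwards [hL.eventually_lt_iterate_inv p (max b (JacobLadder.threshold y₀ / 2))] with T hT
  exact ⟨fun t ht r hr => (hL.hasDerivAt _ (hL.lt_orbit hl hT ht
      (Finset.mem_range.mp hr).le)).differentiableAt,
    hL.isWeight hl hT, hL.isOrthogonalSystem hl hT hf,
    fun n hn => hL.integral_iterated_sq_ne_zero hl hT hn⟩
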